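/- All logarithms are to base 2, $h$ is the binary entropy function, and all quantum systems are finite-dimensional. **Entropies.** The generalized trace distance is $\mathrm{GTD}(\rho,\sigma)=\frac12\|\rho-\sigma\|_1+\frac12|\mathrm{tr}\rho-\mathrm{tr}\sigma|$, and $D_\infty(\rho\|\sigma)=\inf\{\lambda\in\mathbb R:\rho\le 2^\lambda\sigma\}$. Put $H_{\min}(A)_\rho=-D_\infty(\rho_A\|I_A)$ and $H_{\min}(A|B)_\rho=\max_{\sigma_B}-D_\infty(\rho_{AB}\|I_A\otimes\sigma_B)$, the maximum being over density operators. The smooth versions $H^\varepsilon_{\min}$ are the maxima of these quantities over subnormalized states (trace at most 1) within GTD at most $\varepsilon$ of the given state. Classical distributions are treated as diagonal states. **Model.** Let $0<p<\frac12$, let $\varepsilon_A,l_A,\varepsilon_B,l_B\ge0$ and $\theta=(p,\varepsilon_A,l_A,\varepsilon_B,l_B)$. In the $(n,\theta)$-unstructured noisy channel (UsNC) model, Alice and Bob share a two-way noiseless classical channel and one use of a noisy channel from Alice to Bob, as follows. - If both are honest, the noisy channel is the $n$-fold binary symmetric channel with transition probability $p$. - A dishonest Alice may replace it by any channel $W^A:\hat{\mathcal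 X}\to\{0,1\}^n$, with any input set $\hat{\mathcal X}$, such that $H_{\min}^{\varepsilon_A}(\mathbf Z)_{W^A(x)}\ge l_A$ for all $x\in\hat{\mathcal X}$. - A dishonest Bob may replace it by any classical-quantum channel $W^B:\{0,1\}^n\to\mathcal D(\mathcal H_B)$ such that $H_{\min}^{\varepsilon_B}(\mathbf X|B)\ge l_B$ for the joint state of a uniform input $\mathbf X$ and the output $B$. **Commitment.** A string commitment protocol $\Phi$ on a finite message set $\mathcal M$ is a pair of interactive randomized classical systems. Its commit phase consists of finitely many noiseless messages, before and after one use of the noisy channel. Its reveal phase consists of finitely many noiseless messages, after which Bob outputs a message $\hat M$ and a flag $F\in\{\mathrm{acc},\mathrm{rej}\}$. - $\delta_c=\max_m(1-\Pr[\hat M=m,\ F=\mathrm{acc}])$ when both parties are honest and Alice's message is $m$. - $\delta_h$ is the supremum, over all commit strategies of a dishonest Bob (including his choice of $W^B$) and all $m\ne m'$, of $\mathrm{GTD}(\rho_{B'|m},\rho_{B'|m'})$, where $\rho_{B'|m}$ is the state of all information Bob has at the end of the commit phase when honest Alice commits to $m$. - $\delta_b$ is the supremum, over all strategies of a dishonest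 Alice (a channel $W^A$, one commit strategy and two reveal strategies, which interact with two copies of Bob's reveal system), of the probability that both copies accept and output different messages. A rate $R$ is achievable for a sequence of models $(n,\theta_n)$ if for every $0\le R'<R$ there are protocols $\Phi_n$ on message sets $\mathcal M_n$ such that $\delta_c,\delta_h,\delta_b$ of $\Phi_n$ in the $(n,\theta_n)$-UsNC model tend to $0$ and $\frac1n\log|\mathcal M_n|\to R'$. **Theorem.** Let $g_p:[0,p]\to[2p,h(p)]$, $g_p(\sigma)=(1-2\sigma)\,h\!\left(\frac{p-\sigma}{1-2\sigma}\right)+2\sigma$, a decreasing bijection. Let $\theta_n=(p,\varepsilon_{A,n},l_{A,n},\varepsilon_{B,n},l_{B,n})$ satisfy $$\lim_{n\to\infty}\varepsilon_{A,n}=\lim_{n\to\infty}\varepsilon_{B,n}=0,\qquad \liminf_{n\to\infty}\frac{l_{A,n}}n=\xi_A\in[2p,h(p)],\qquad \liminf_{n\to\infty}\frac{l_{B,n}}n=\xi_B\in[0,h(p)],$$ and assume $g_p^{-1}(\xi_A)\le\frac14$ (automatic if $p\le\frac14$). Then the rate $$R=\xi_B-h\bigl(2g_p^{-1}(\xi_A)\bigr)$$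 is achievable. -/

import Mathlib

open Filter Topology
open scoped ENNReal Kronecker ComplexOrder

noncomputable section

namespace UsNC

/-! ### Binary entropy and the function `g_p` -/

/-- The binary entropy function in bits, `h(x) = -x log₂ x - (1-x) log₂ (1-x)`. -/
def h (x : ℝ) : ℝ := Real.binEntropy x / Real.log 2

/-- `g_p(σ) = (1-2σ) h((p-σ)/(1-2σ)) + 2σ`. -/
def g (p σ : ℝ) : ℝ := (1 - 2 * σ) * h ((p - σ) / (1 - 2 * σ)) + 2 * σ

/-- The inverse of the decreasing bijection `g_p : [0, p] → [2p, h(p)]`. -/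
def gInv (p ξ : ℝ) : ℝ := Function.invFunOn (g p) (Set.Icc 0 p) ξ

/-! ### Classical smooth min-entropy -/

section Classical

variable {Z : Type*} [Fintype Z]

/-- Subnormalized distributions on a finite set. -/
def IsSubDist (Q : Z → ℝ) : Prop := (∀ z, 0 ≤ Q z) ∧ ∑ z, Q z ≤ 1

/-- Generalized trace distance of two functions on a finite set. -/
def gtdC (P Q : Z → ℝ) : ℝ :=
  (1 / 2) * ∑ z, |P z - Q z| + (1 / 2) * |∑ z, P z - ∑ z, Q z|

/-- Min-entropy `-log₂ max_z P(z)`, that is minus the infimum of all real `c` such that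
`P ≤ 2^c` (with value `+∞` for `P = 0`). -/
def HminC (P : Z → ℝ) : EReal :=
  - ⨅ (c : ℝ) (_ : ∀ z, P z ≤ (2 : ℝ) ^ c), (c : EReal)

/-- Smooth min-entropy of a function on a finite set. -/
def smoothHminC (ε : ℝ) (P : Z → ℝ) : EReal :=
  ⨆ (Q : Z → ℝ) (_ : IsSubDist Q) (_ : gtdC Q P ≤ ε), HminC Q

end Classical

/-! ### Quantum states on finite-dimensional systems and smooth conditional min-entropy -/

section Quantum

variable {ι : Type*} [Fintype ι] [DecidableEq ι]

/-- Density operators. -/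
def IsState (ρ : Matrix ι ι ℂ) : Prop := ρ.PosSemidef ∧ ρ.trace = 1

/-- Subnormalized states. -/
def IsSubState (ρ : Matrix ι ι ℂ) : Prop := ρ.PosSemidef ∧ ρ.trace.re ≤ 1

/-- The trace norm: the sum of the singular values. -/
def traceNorm (A : Matrix ι ι ℂ) : ℝ :=
  ∑ i, √((Matrix.isHermitian_conjTranspose_mul_self A).eigenvalues i)

/-- Generalized trace distance `½ ‖ρ - σ‖₁ + ½ |tr ρ - tr σ|`. -/
def gtd (ρ σ : Matrix ι ι ℂ) : ℝ :=
  (1 / 2) * traceNorm (ρ - σ) + (1 / 2) * ‖ρ.trace - σ.trace‖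

/-- `D_∞(ρ ‖ σ) = inf {c ∈ ℝ : ρ ≤ 2^c σ}`. -/
def Dmax (ρ σ : Matrix ι ι ℂ) : EReal :=
  ⨅ (c : ℝ) (_ : (((2 : ℝ) ^ c) • σ - ρ).PosSemidef), (c : EReal)

variable {X B : Type*} [Fintype X] [DecidableEq X] [Fintype B] [DecidableEq B]

/-- Conditional min-entropy `H_min(X|B)_ρ`. -/
def Hmin (ρ : Matrix (X × B) (X × B) ℂ) : EReal :=
  ⨆ (σ : Matrix B B ℂ) (_ : IsState σ), - Dmax ρ ((1 : Matrix X X ℂ) ⊗ₖ σ)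

/-- Smooth conditional min-entropy `H_min^ε(X|B)_ρ`. -/
def smoothHmin (ε : ℝ) (ρ : Matrix (X × B) (X × B) ℂ) : EReal :=
  ⨆ (ρ' : Matrix (X × B) (X × B) ℂ) (_ : IsSubState ρ') (_ : gtd ρ' ρ ≤ ε), Hmin ρ'

/-- The classical-quantum operator `∑ x, |x⟩⟨x| ⊗ τ x`. -/
def cqOp (τ : X → Matrix B B ℂ) : Matrix (X × B) (X × B) ℂ :=
  Matrix.of fun a b => if a.1 = b.1 then τ a.1 a.2 b.2 else 0

end Quantum

/-- A quantum instrument on a `d`-dimensional register with outcomes in `S`, given by Kraus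
operators. -/
structure Instrument (d : ℕ) (S : Type) [Fintype S] where
  /-- number of Kraus operators per outcome -/
  num : ℕ
  /-- Kraus operators of each outcome -/
  kraus : S → Fin num → Matrix (Fin d) (Fin d) ℂ
  complete : ∑ b, ∑ j, (kraus b j).conjTranspose * kraus b j = 1

/-- The unnormalized state after outcome `b`. -/
def Instrument.apply {d : ℕ} {S : Type} [Fintype S] (I : Instrument d S) (b : S)
    (ρ : Matrix (Fin d) (Fin d) ℂ) : Matrix (Fin d) (Fin d) ℂ :=
  ∑ j, I.kraus b j * ρ * (I.kraus b j).conjTranspose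

/-! ### The unstructured noisy channel model -/

/-- Binary strings of length `n`. -/
abbrev Bits (n : ℕ) := Fin n → ZMod 2

/-- Parameter list `θ = (p, ε_A, l_A, ε_B, l_B)`. -/
structure Params where
  p : ℝ
  epsA : ℝ
  lA : ℝ
  epsB : ℝ
  lB : ℝ
  p_pos : 0 < p
  p_lt : p < 1 / 2
  epsA_nonneg : 0 ≤ epsA
  lA_nonneg : 0 ≤ lA
  epsB_nonneg : 0 ≤ epsB
  lB_nonneg : 0 ≤ lB

/-- Honest channel: the `n`-fold binary symmetric channel with transition probability `p`,
`W^n(z|x) = ∏ i, (if z i = x i then 1 - p else p)`. -/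
def bsc (n : ℕ) (θ : Params) (x : Bits n) : PMF (Bits n) :=
  PMF.ofFintype (fun z => ∏ i, ENNReal.ofReal (if z i = x i then 1 - θ.p else θ.p)) (by
    have hs : ∀ i : Fin n,
        ∑ c : ZMod 2, ENNReal.ofReal (if c = x i then 1 - θ.p else θ.p) = 1 := by
      intro i
      have h1 := θ.p_pos
      have h2 := θ.p_lt
      rw [← ENNReal.ofReal_sum_of_nonneg]
      · have : ∀ y : ZMod 2, ∑ c : ZMod 2, (if c = y then 1 - θ.p else θ.p) = 1 := by
          intro y
          have hu : (Finset.univ : Finset (ZMod 2)) = {0, 1} := by decide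
          rw [hu, Finset.sum_pair (by decide)]
          have hy : y = 0 ∨ y = 1 := by revert y; decide
          rcases hy with rfl | rfl <;> simp
        rw [this, ENNReal.ofReal_one]
      · intro c _
        split_ifs <;> linarith
    have := Fintype.prod_sum
      (fun (i : Fin n) (c : ZMod 2) => ENNReal.ofReal (if c = x i then 1 - θ.p else θ.p))
    rw [← this]
    simp [hs])

/-- Constraint on the channel of a dishonest sender: each output distribution has smooth
min-entropy at least `l_A`. -/
def AliceConstraint (n : ℕ) (θ : Params) {I : Type} (W : I → PMF (Bits n)) : Prop :=
  ∀ x, (θ.lA : EReal) ≤ smoothHminC θ.epsA (fun z => (W x z).toReal)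

/-- Constraint on the cq channel of a dishonest receiver: its values are states, and for uniform
input `X` the smooth min-entropy of `X` given the output is at least `l_B`. -/
def BobConstraint (n : ℕ) (θ : Params) {d : ℕ}
    (W : Bits n → Matrix (Fin d) (Fin d) ℂ) : Prop :=
  (∀ x, IsState (W x)) ∧
    (θ.lB : EReal) ≤ smoothHmin θ.epsB (cqOp fun x => ((2 : ℝ) ^ n)⁻¹ • W x)

/-! ### Interactive commitment protocols -/

/-- The sender of a message over the noiseless channel. -/
inductive Party
  | alice
  | bob

/-- Run noiseless communication: `s` lists whose turn it is, `t` is the transcript so far, and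
`a`, `b` produce the next symbol of each party from the transcript. Returns the new transcript. -/
def run {S : Type} (a b : List S → S) : List Party → List S → List S
  | [], t => t
  | Party.alice :: s, t => run a b s (t ++ [a t])
  | Party.bob :: s, t => run a b s (t ++ [b t])

/-- An interactive protocol for committing to a message in `M` with one use of the noisy channel
with `n`-bit inputs and outputs. Every interactive random system is given by random coins together
with deterministic maps of the coins and of everything the party has received. -/
structure Protocol (n : ℕ) (M : Type) where
  /-- symbols of the noiseless channel -/
  Sym : Type
  /-- Alice's coins, for both phases -/
  CoinA : Type
  /-- Bob's coins for the commit phase, remembered in the reveal phase -/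
  CoinB : Type
  /-- Bob's fresh coins for the reveal phase -/
  CoinR : Type
  [fintypeSym : Fintype Sym]
  [decEqSym : DecidableEq Sym]
  [fintypeA : Fintype CoinA]
  [fintypeB : Fintype CoinB]
  [fintypeR : Fintype CoinR]
  coinA : PMF CoinA
  coinB : PMF CoinB
  coinR : PMF CoinR
  /-- turns of the commit phase before the use of the noisy channel -/
  pre : List Party
  /-- turns of the commit phase after the use of the noisy channel -/
  post : List Party
  /-- turns of the reveal phase -/
  reveal : List Party
  /-- Alice's next symbol, from message, coins and transcript -/
  aliceMsg : M → CoinA → List Sym → Sym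
  /-- Alice's input to the noisy channel -/
  aliceInput : M → CoinA → List Sym → Bits n
  /-- Bob's next symbol, before the use of the noisy channel -/
  bobPre : CoinB → List Sym → Sym
  /-- Bob's next symbol in the commit phase, after the use of the noisy channel -/
  bobPost : CoinB → Bits n → List Sym → Sym
  /-- Bob's next symbol in the reveal phase -/
  bobReveal : CoinB → CoinR → Bits n → List Sym → Sym
  /-- Bob's final output: the revealed message and whether he accepts -/
  bobOut : CoinB → CoinR → Bits n → List Sym → M × Bool

attribute [instance] Protocol.fintypeSym Protocol.decEqSym Protocol.fintypeA
  Protocol.fintypeB Protocol.fintypeR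

variable {n : ℕ} {M : Type}

/-- Bob's output (revealed message, acceptance flag) when both parties are honest and the message
is `m`. -/
def honestRun (θ : Params) (Φ : Protocol n M) (m : M) : PMF (M × Bool) :=
  Φ.coinA.bind fun a => Φ.coinB.bind fun b =>
    let t₀ := run (Φ.aliceMsg m a) (Φ.bobPre b) Φ.pre []
    (bsc n θ (Φ.aliceInput m a t₀)).bind fun z =>
      let t₁ := run (Φ.aliceMsg m a) (Φ.bobPost b z) Φ.post t₀
      Φ.coinR.bind fun r =>
        PMF.pure (Φ.bobOut b r z (run (Φ.aliceMsg m a) (Φ.bobReveal b r z) Φ.reveal t₁))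

/-- The completeness parameter `δ_c`. -/
def deltaC (θ : Params) (Φ : Protocol n M) : ℝ≥0∞ :=
  ⨆ m : M, (1 - (honestRun θ Φ m).toOuterMeasure {(m, true)})

/-- A strategy of dishonest Bob in the commit phase. He may choose his cq channel depending on his
coins and on the transcript. He holds a `d`-dimensional register after the use of the channel, and
produces each later symbol by an instrument on it. -/
structure DishonestBob (θ : Params) (Φ : Protocol n M) where
  /-- Bob's private coins -/
  Coin : Type
  [fintypeCoin : Fintype Coin]
  [decEqCoin : DecidableEq Coin]
  coin : PMF Coin
  /-- dimension of the register -/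
  d : ℕ
  /-- next symbol before the use of the noisy channel -/
  msgPre : Coin → List Φ.Sym → Φ.Sym
  /-- the chosen cq channel -/
  W : Coin → List Φ.Sym → Bits n → Matrix (Fin d) (Fin d) ℂ
  W_constraint : ∀ c t, BobConstraint n θ (W c t)
  /-- the instrument whose outcome is the next symbol after the use of the noisy channel -/
  inst : Coin → List Φ.Sym → Instrument d Φ.Sym

attribute [instance] DishonestBob.fintypeCoin DishonestBob.decEqCoin

/-- Interaction of honest Alice with next-symbol map `a` and a party that holds a quantum register:
from transcript `t` and register state `ρ`, returns the unnormalized register state jointly with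
each possible final transcript. -/
def evolve {S : Type} [Fintype S] [DecidableEq S] {d : ℕ} (a : List S → S)
    (inst : List S → Instrument d S) :
    List Party → List S → Matrix (Fin d) (Fin d) ℂ → List S → Matrix (Fin d) (Fin d) ℂ
  | [], t, ρ => fun t' => if t' = t then ρ else 0
  | Party.alice :: s, t, ρ => evolve a inst s (t ++ [a t]) ρ
  | Party.bob :: s, t, ρ => fun t' => ∑ b, evolve a inst s (t ++ [b]) ((inst t).apply b ρ) t'

/-- The state of all the information dishonest Bob has at the end of the commit phase (his coins,
the transcript and his register), when Alice commits to `m`. -/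
def bobState {θ : Params} {Φ : Protocol n M} (S : DishonestBob θ Φ) (m : M) :
    Matrix ((S.Coin × (Fin (Φ.pre.length + Φ.post.length) → Φ.Sym)) × Fin S.d)
      ((S.Coin × (Fin (Φ.pre.length + Φ.post.length) → Φ.Sym)) × Fin S.d) ℂ :=
  cqOp fun ct => (S.coin ct.1).toReal • ∑ a, (Φ.coinA a).toReal •
    (let t₀ := run (Φ.aliceMsg m a) (S.msgPre ct.1) Φ.pre []
     evolve (Φ.aliceMsg m a) (S.inst ct.1) Φ.post t₀
       (S.W ct.1 t₀ (Φ.aliceInput m a t₀)) (List.ofFn ct.2))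

/-- The hiding parameter `δ_h`. -/
def deltaH (θ : Params) (Φ : Protocol n M) : ℝ≥0∞ :=
  ⨆ (S : DishonestBob θ Φ) (m : M) (m' : M) (_ : m ≠ m'),
    ENNReal.ofReal (gtd (bobState S m) (bobState S m'))

/-- A strategy of dishonest Alice: a channel with an arbitrary input set that obeys the constraint,
a strategy for the commit phase, and two strategies for the reveal phase. All of them may use the
same coins. -/
structure DishonestAlice (θ : Params) (Φ : Protocol n M) where
  /-- Alice's private coins -/
  Coin : Type
  coin : PMF Coin
  /-- input set of the channel -/
  Inp : Type
  W : Inp → PMF (Bits n)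
  W_constraint : AliceConstraint n θ W
  /-- next symbol in the commit phase -/
  msg : Coin → List Φ.Sym → Φ.Sym
  /-- input to the noisy channel -/
  input : Coin → List Φ.Sym → Inp
  /-- next symbol in the reveal phase, first strategy -/
  reveal₀ : Coin → List Φ.Sym → Φ.Sym
  /-- next symbol in the reveal phase, second strategy -/
  reveal₁ : Coin → List Φ.Sym → Φ.Sym

/-- Outputs of the two copies of Bob's reveal system when Alice is dishonest. -/
def bindingRun {θ : Params} {Φ : Protocol n M} (S : DishonestAlice θ Φ) :
    PMF ((M × Bool) × (M × Bool)) :=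
  S.coin.bind fun a => Φ.coinB.bind fun b =>
    let t₀ := run (S.msg a) (Φ.bobPre b) Φ.pre []
    (S.W (S.input a t₀)).bind fun z =>
      let t₁ := run (S.msg a) (Φ.bobPost b z) Φ.post t₀
      Φ.coinR.bind fun r₀ => Φ.coinR.bind fun r₁ =>
        PMF.pure
          (Φ.bobOut b r₀ z (run (S.reveal₀ a) (Φ.bobReveal b r₀ z) Φ.reveal t₁),
           Φ.bobOut b r₁ z (run (S.reveal₁ a) (Φ.bobReveal b r₁ z) Φ.reveal t₁))

/-- The binding parameter `δ_b`. -/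
def deltaB (θ : Params) (Φ : Protocol n M) : ℝ≥0∞ :=
  ⨆ S : DishonestAlice θ Φ, (bindingRun S).toOuterMeasure
    {o | o.1.2 = true ∧ o.2.2 = true ∧ o.1.1 ≠ o.2.1}

/-- Achievability of the commitment rate `R` for the models `(n, θ n)`: every rate
`0 ≤ R' < R` is the limiting rate of a sequence of protocols with vanishing completeness,
hiding and binding parameters. (Rates `log₂ |M| / n` are never negative.) -/
def Achievable (θ : ℕ → Params) (R : ℝ) : Prop :=
  ∀ R' : ℝ, 0 ≤ R' → R' < R →
    ∃ (M : ℕ → Type) (_ : ∀ n, Fintype (M n)) (_ : ∀ n, Nonempty (M n))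
      (Φ : ∀ n, Protocol n (M n)),
      Tendsto (fun n => deltaC (θ n) (Φ n)) atTop (𝓝 0) ∧
      Tendsto (fun n => deltaH (θ n) (Φ n)) atTop (𝓝 0) ∧
      Tendsto (fun n => deltaB (θ n) (Φ n)) atTop (𝓝 0) ∧
      Tendsto (fun n => Real.logb 2 (Fintype.card (M n)) / (n : ℝ)) atTop (𝓝 R')

end UsNC

end

/-!
The protocol needs no interaction. Alice sends a uniform string `x` through the noisy channel and
publishes the parity checks `H x` for a linear code of large minimum distance, a random matrix `r`
and the masked message `m + r x`. She opens by sending `x`, and Bob tests the parity checks and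
whether the distance of `x` from his channel output `z` is at most `(p + δ) n`.

*Binding.* Two openings with the same parity checks are equal or have distance at least `2 σ' n`,
where `σ'` is slightly larger than `σ = gInv p ξA`. The number of `z` within distance `(p + δ) n`
of two such centres is estimated by the weights `u ^ (d(x₀, z) + d(x₁, z))`, whose sum over `z` is a
product (`card_inter_ball_le`). For the optimal `u` at `σ` the exponent is `g p σ = ξA`, and it is
strictly smaller at `σ'` (`exists_pairExponent_lt`), so a distribution of smooth min-entropy about
`ξA n` gives this set vanishing probability. A code with `h (2 σ') n` parity checks exists by the
Gilbert–Varshamov argument (`exists_parityCheck`).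

*Hiding.* This is a leftover hash lemma against quantum side information
(`sum_traceNorm_hashCoeff_le`). The difference of Bob's states for two messages is a family of
linear combinations of the conditional operators `ρ x`; since `r` is a uniform matrix, the
coefficient vectors of different `x` are exactly orthogonal. With `ρ x ≤ c τ` and the weighted
Hilbert–Schmidt bound `2 ‖Δ‖₁ ≤ t tr τ + t⁻¹ tr (Δ τ⁻¹ Δᴴ)`, only the diagonal terms
`tr (ρ x τ⁻¹ ρ x) ≤ c tr (ρ x)` remain (`sum_traceNorm_le_of_orthogonal`). Everything about the
trace norm comes from its duality with contractions. The hidden message may thus have nearly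
`lB - h (2 σ') n` bits.

*Completeness* is a Chernoff bound for the binary symmetric channel (`bsc_toOuterMeasure_le`).
-/

noncomputable section

namespace UsNC

/-! ### Duality for the trace norm -/

section TraceNorm

set_option linter.unusedSectionVars false

open Matrix

variable {ι κ : Type*} [Fintype ι] [DecidableEq ι] [Fintype κ] [DecidableEq κ]

/-- Contractions, `Uᴴ U ≤ 1`. -/
def IsContraction (U : Matrix ι ι ℂ) : Prop := (1 - Uᴴ * U).PosSemidef

lemma isContraction_one : IsContraction (1 : Matrix ι ι ℂ) := by
  simp [IsContraction, PosSemidef.zero]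

lemma IsContraction.norm_le {U : Matrix ι ι ℂ} (hU : IsContraction U) (v : EuclideanSpace ℂ ι) :
    ‖toEuclideanLin U v‖ ≤ ‖v‖ := by
  have h := hU.re_dotProduct_nonneg v.ofLp
  have h1 : ‖toEuclideanLin U v‖ ^ 2 ≤ ‖v‖ ^ 2 := by
    rw [norm_sq_eq_re_inner (𝕜 := ℂ), norm_sq_eq_re_inner (𝕜 := ℂ) v,
      EuclideanSpace.inner_eq_star_dotProduct, EuclideanSpace.inner_eq_star_dotProduct]
    rw [sub_mulVec, one_mulVec, dotProduct_sub, map_sub, ← mulVec_mulVec,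
      dotProduct_mulVec, ← star_mulVec, sub_nonneg] at h
    rw [dotProduct_comm, dotProduct_comm v.ofLp]
    exact h
  exact le_of_sq_le_sq h1 (norm_nonneg _)

/-- Contractions give lower bounds on the trace norm: evaluate the trace in an eigenbasis of
`Aᴴ A`. -/
lemma trace_mul_re_le_traceNorm {U : Matrix ι ι ℂ} (hU : IsContraction U) (A : Matrix ι ι ℂ) :
    (U * A).trace.re ≤ traceNorm A := by
  set hA := isHermitian_conjTranspose_mul_self A with hAdef
  have htr : (U * A).trace
      = ∑ i, inner ℂ (hA.eigenvectorBasis i)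
          (toEuclideanLin U (toEuclideanLin A (hA.eigenvectorBasis i))) := by
    have h1 := LinearMap.trace_eq_sum_inner (toEuclideanLin (U * A)) hA.eigenvectorBasis
    have h2 : LinearMap.trace ℂ _ (toEuclideanLin (U * A)) = (U * A).trace := by
      rw [toEuclideanLin, toLpLin_eq_toLin, Matrix.trace_toLin_eq]
    rw [← h2, h1]
    refine Finset.sum_congr rfl fun i _ => ?_
    congr 1
    ext j
    simp [toEuclideanLin, mulVec_mulVec]
  rw [htr, Complex.re_sum, traceNorm]
  refine Finset.sum_le_sum fun i _ => ?_
  refine (Complex.re_le_norm _).trans ((norm_inner_le_norm _ _).trans ?_)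
  rw [hA.eigenvectorBasis.orthonormal.1 i, one_mul]
  refine (hU.norm_le _).trans ?_
  apply Real.le_sqrt_of_sq_le
  rw [norm_sq_eq_re_inner (𝕜 := ℂ), EuclideanSpace.inner_eq_star_dotProduct, dotProduct_comm]
  have h3 := hA.mulVec_eigenvectorBasis i
  have h4 : star (A *ᵥ (hA.eigenvectorBasis i).ofLp) ⬝ᵥ (A *ᵥ (hA.eigenvectorBasis i).ofLp)
      = hA.eigenvalues i := by
    rw [star_mulVec, ← dotProduct_mulVec, mulVec_mulVec, h3, dotProduct_smul, dotProduct_comm,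
      ← EuclideanSpace.inner_eq_star_dotProduct, inner_self_eq_norm_sq_to_K,
      hA.eigenvectorBasis.orthonormal.1 i]
    simp
  have h5 : star (toEuclideanLin A (hA.eigenvectorBasis i)).ofLp ⬝ᵥ
      (toEuclideanLin A (hA.eigenvectorBasis i)).ofLp = hA.eigenvalues i := h4
  rw [h5]
  simp

/-- The trace norm is attained at a contraction, the adjoint of the partial isometry in the polar
decomposition of `A`. -/
lemma exists_trace_mul_eq_traceNorm (A : Matrix ι ι ℂ) :
    ∃ U : Matrix ι ι ℂ, IsContraction U ∧ (U * A).trace = traceNorm A := by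
  set hA := isHermitian_conjTranspose_mul_self A with hAdef
  set l := hA.eigenvalues with hl
  set V : Matrix ι ι ℂ := (hA.eigenvectorUnitary : Matrix ι ι ℂ) with hV
  have hl0 : ∀ i, 0 ≤ l i := eigenvalues_conjTranspose_mul_self_nonneg A
  have hVV : Vᴴ * V = 1 := Unitary.coe_star_mul_self hA.eigenvectorUnitary
  have hsp : Vᴴ * (Aᴴ * A) * V = diagonal (fun i => (l i : ℂ)) := by
    have := hA.conjStarAlgAut_star_eigenvectorUnitary
    rw [Unitary.conjStarAlgAut_apply] at this
    simp only [Unitary.coe_star, star_star] at this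
    exact this
  -- `D` is the pseudo-inverse of the square root of the eigenvalue matrix
  set D : Matrix ι ι ℂ := diagonal (fun i => ((√(l i))⁻¹ : ℂ)) with hD
  have hDH : Dᴴ = D := by
    rw [hD, diagonal_conjTranspose]; congr 1; ext i; simp
  have hsq : ∀ i, ((√(l i) : ℝ) : ℂ) * √(l i) = l i := fun i => by
    rw [← Complex.ofReal_mul, Real.mul_self_sqrt (hl0 i)]
  refine ⟨V * D * (A * V)ᴴ, ?_, ?_⟩
  · set P := (A * V) * D * D * (A * V)ᴴ with hP
    have hUU : (V * D * (A * V)ᴴ)ᴴ * (V * D * (A * V)ᴴ) = P := by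
      rw [conjTranspose_mul, conjTranspose_conjTranspose, conjTranspose_mul, hDH, hP]
      calc A * V * (D * Vᴴ) * (V * D * (A * V)ᴴ)
          = A * V * D * (Vᴴ * V) * D * (A * V)ᴴ := by simp only [Matrix.mul_assoc]
        _ = _ := by rw [hVV, Matrix.mul_one]
    have hAV : (A * V)ᴴ * (A * V) = diagonal (fun i => (l i : ℂ)) := by
      rw [conjTranspose_mul, ← hsp]; simp only [Matrix.mul_assoc]
    have hDD : D * D * diagonal (fun i => (l i : ℂ)) * D * D = D * D := by
      simp only [hD, diagonal_mul_diagonal]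
      congr 1; ext i
      by_cases h0 : (√(l i) : ℂ) = 0
      · simp [h0]
      · rw [← hsq]; field_simp
    have hPP : P * P = P := by
      calc P * P = A * V * (D * D * ((A * V)ᴴ * (A * V)) * D * D) * (A * V)ᴴ := by
            rw [hP]; simp only [Matrix.mul_assoc]
        _ = P := by rw [hAV, hDD, hP]; simp only [Matrix.mul_assoc]
    have hPH : Pᴴ = P := by
      rw [hP]; simp only [conjTranspose_mul, conjTranspose_conjTranspose, hDH, Matrix.mul_assoc]
    rw [IsContraction, hUU]
    have : (1 - P) = (1 - P)ᴴ * (1 - P) := by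
      rw [conjTranspose_sub, conjTranspose_one, hPH, Matrix.mul_sub, Matrix.mul_one,
        Matrix.sub_mul, Matrix.one_mul, hPP, sub_self, sub_zero]
    rw [this]
    exact posSemidef_conjTranspose_mul_self _
  · rw [Matrix.mul_assoc, Matrix.trace_mul_comm, conjTranspose_mul]
    have : Vᴴ * Aᴴ * A * (V * D) = diagonal (fun i => (l i : ℂ)) * D := by
      rw [← hsp]; simp only [Matrix.mul_assoc]
    rw [this, hD, diagonal_mul_diagonal, trace_diagonal, traceNorm, Complex.ofReal_sum]
    refine Finset.sum_congr rfl fun i _ => ?_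
    change (l i : ℂ) * (√(l i) : ℂ)⁻¹ = ((√(l i) : ℝ) : ℂ)
    by_cases h0 : (√(l i) : ℂ) = 0
    · simp [h0]
    · rw [← hsq]; field_simp

/-- Upper bounds on the trace norm may be checked on contractions. -/
lemma traceNorm_le_of_forall {A : Matrix ι ι ℂ} {r : ℝ}
    (h : ∀ U, IsContraction U → (U * A).trace.re ≤ r) : traceNorm A ≤ r := by
  obtain ⟨U, hU, h1⟩ := exists_trace_mul_eq_traceNorm A
  have := h U hU
  rwa [h1, Complex.ofReal_re] at this

lemma traceNorm_nonneg (A : Matrix ι ι ℂ) : 0 ≤ traceNorm A :=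
  Finset.sum_nonneg fun _ _ => Real.sqrt_nonneg _

lemma traceNorm_zero : traceNorm (0 : Matrix ι ι ℂ) = 0 :=
  le_antisymm (traceNorm_le_of_forall fun U _ => by simp) (traceNorm_nonneg _)

lemma traceNorm_add_le (A B : Matrix ι ι ℂ) : traceNorm (A + B) ≤ traceNorm A + traceNorm B :=
  traceNorm_le_of_forall fun U hU => by
    rw [Matrix.mul_add, trace_add, Complex.add_re]
    exact add_le_add (trace_mul_re_le_traceNorm hU A) (trace_mul_re_le_traceNorm hU B)

lemma traceNorm_sum_le {J : Type*} (s : Finset J) (A : J → Matrix ι ι ℂ) :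
    traceNorm (∑ j ∈ s, A j) ≤ ∑ j ∈ s, traceNorm (A j) :=
  Finset.le_sum_of_subadditive _ traceNorm_zero.le traceNorm_add_le _ _

lemma IsContraction.smul {U : Matrix ι ι ℂ} (hU : IsContraction U) {z : ℂ} (hz : ‖z‖ = 1) :
    IsContraction (z • U) := by
  have : (z • U)ᴴ * (z • U) = Uᴴ * U := by
    rw [conjTranspose_smul, smul_mul_smul_comm, Complex.star_def, ← Complex.normSq_eq_conj_mul_self,
      Complex.normSq_eq_norm_sq, hz]
    simp
  rw [IsContraction, this]
  exact hU

lemma norm_trace_mul_le_traceNorm {U : Matrix ι ι ℂ} (hU : IsContraction U) (A : Matrix ι ι ℂ) :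
    ‖(U * A).trace‖ ≤ traceNorm A := by
  by_cases h0 : (U * A).trace = 0
  · rw [h0, norm_zero]; exact traceNorm_nonneg A
  have hn : ‖(U * A).trace‖ ≠ 0 := norm_ne_zero_iff.2 h0
  have h1 := trace_mul_re_le_traceNorm (hU.smul (z := (starRingEnd ℂ (U * A).trace) / ‖(U * A).trace‖)
    (by simp [hn])) A
  rw [Matrix.smul_mul, trace_smul, smul_eq_mul, div_mul_eq_mul_div, ← Complex.normSq_eq_conj_mul_self,
    Complex.normSq_eq_norm_sq, ← Complex.ofReal_div, Complex.ofReal_re] at h1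
  rwa [sq, mul_div_assoc, div_self hn, mul_one] at h1

lemma traceNorm_real_smul_le (c : ℝ) (A : Matrix ι ι ℂ) :
    traceNorm (c • A) ≤ |c| * traceNorm A :=
  traceNorm_le_of_forall fun U hU => by
    rw [Matrix.mul_smul, trace_smul, Complex.smul_re, smul_eq_mul]
    calc c * (U * A).trace.re ≤ |c| * |(U * A).trace.re| := by rw [← abs_mul]; exact le_abs_self _
      _ ≤ |c| * traceNorm A := by
        gcongr
        exact (Complex.abs_re_le_norm _).trans (norm_trace_mul_le_traceNorm hU A)

lemma gtd_le_traceNorm (ρ σ : Matrix ι ι ℂ) : gtd ρ σ ≤ traceNorm (ρ - σ) := by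
  have := norm_trace_mul_le_traceNorm isContraction_one (ρ - σ)
  rw [Matrix.one_mul, trace_sub] at this
  rw [gtd]; linarith

lemma traceNorm_le_two_gtd (ρ σ : Matrix ι ι ℂ) : traceNorm (ρ - σ) ≤ 2 * gtd ρ σ := by
  have := norm_nonneg (ρ.trace - σ.trace)
  rw [gtd]; linarith

/-! ### Classical-quantum operators -/

/-- The diagonal block of an operator on `X ⊗ B` at `x`. -/
def block (A : Matrix (κ × ι) (κ × ι) ℂ) (x : κ) : Matrix ι ι ℂ :=
  A.submatrix (fun b => (x, b)) (fun b => (x, b))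

lemma block_cqOp (τ : κ → Matrix ι ι ℂ) (x : κ) : block (cqOp τ) x = τ x := by
  ext i j; simp [block, cqOp]

lemma cqOp_mul (σ τ : κ → Matrix ι ι ℂ) : cqOp σ * cqOp τ = cqOp fun x => σ x * τ x := by
  ext ⟨x, i⟩ ⟨y, j⟩
  simp only [cqOp, mul_apply, of_apply, Fintype.sum_prod_type]
  rw [Finset.sum_eq_single x]
  · by_cases h : x = y
    · subst h; simp
    · simp [h]
  · intro z _ hz; simp [Ne.symm hz]
  · simp

lemma cqOp_conjTranspose (σ : κ → Matrix ι ι ℂ) : (cqOp σ)ᴴ = cqOp fun x => (σ x)ᴴ := by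
  ext ⟨x, i⟩ ⟨y, j⟩
  by_cases h : x = y
  · subst h; simp [cqOp]
  · simp [cqOp, h, Ne.symm h]

lemma cqOp_one : cqOp (fun _ : κ => (1 : Matrix ι ι ℂ)) = 1 := by
  ext ⟨x, i⟩ ⟨y, j⟩
  by_cases h : x = y
  · subst h; simp [cqOp, one_apply]
  · simp [cqOp, h, one_apply]

lemma cqOp_sub (σ τ : κ → Matrix ι ι ℂ) : cqOp σ - cqOp τ = cqOp fun x => σ x - τ x := by
  ext ⟨x, i⟩ ⟨y, j⟩
  by_cases h : x = y
  · subst h; simp [cqOp]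
  · simp [cqOp, h]

lemma trace_eq_sum_block (A : Matrix (κ × ι) (κ × ι) ℂ) : A.trace = ∑ x, (block A x).trace := by
  simp [Matrix.trace, block, Fintype.sum_prod_type]

lemma block_cqOp_mul (σ : κ → Matrix ι ι ℂ) (A : Matrix (κ × ι) (κ × ι) ℂ) (x : κ) :
    block (cqOp σ * A) x = σ x * block A x := by
  ext i j
  simp only [block, submatrix_apply, mul_apply, cqOp, of_apply, Fintype.sum_prod_type]
  rw [Finset.sum_eq_single x]
  · simp
  · intro z _ hz; simp [Ne.symm hz]
  · simp

lemma block_mul_cqOp (σ : κ → Matrix ι ι ℂ) (A : Matrix (κ × ι) (κ × ι) ℂ) (x : κ) :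
    block (A * cqOp σ) x = block A x * σ x := by
  ext i j
  simp only [block, submatrix_apply, mul_apply, cqOp, of_apply, Fintype.sum_prod_type]
  rw [Finset.sum_eq_single x]
  · simp
  · intro z _ hz; simp [hz]
  · simp

lemma posSemidef_cqOp {σ : κ → Matrix ι ι ℂ} (h : ∀ x, (σ x).PosSemidef) :
    (cqOp σ).PosSemidef := by
  choose B hB using fun x => (by
    open scoped MatrixOrder in
    exact CStarAlgebra.nonneg_iff_eq_star_mul_self.1 (nonneg_iff_posSemidef.2 (h x)) :
      ∃ B : Matrix ι ι ℂ, σ x = star B * B)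
  have : cqOp σ = (cqOp B)ᴴ * cqOp B := by
    rw [cqOp_conjTranspose, cqOp_mul]; congr 1; ext1 x; exact hB x
  rw [this]; exact posSemidef_conjTranspose_mul_self _

lemma isContraction_cqOp {U : κ → Matrix ι ι ℂ} (hU : ∀ x, IsContraction (U x)) :
    IsContraction (cqOp U) := by
  rw [IsContraction, cqOp_conjTranspose, cqOp_mul, ← cqOp_one, cqOp_sub]
  exact posSemidef_cqOp hU

/-- The rest of the `x`-th block column contributes a positive operator to the `x`-th block of
`Uᴴ U`. -/
lemma isContraction_block {U : Matrix (κ × ι) (κ × ι) ℂ} (hU : IsContraction U) (x : κ) :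
    IsContraction (block U x) := by
  have h1 : (block (1 - Uᴴ * U) x).PosSemidef := hU.submatrix _
  have h2 : 1 - (block U x)ᴴ * block U x = block (1 - Uᴴ * U) x
      + ∑ y ∈ Finset.univ.erase x, (U.submatrix (fun b => (y, b)) (fun b => (x, b)))ᴴ
          * U.submatrix (fun b => (y, b)) (fun b : ι => (x, b)) := by
    ext i j
    simp only [block, Matrix.sub_apply, Matrix.add_apply, mul_apply, submatrix_apply, conjTranspose_apply,
      Matrix.sum_apply, Fintype.sum_prod_type]
    rw [← Finset.add_sum_erase Finset.univ _ (Finset.mem_univ x)]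
    simp [one_apply]
  rw [IsContraction, h2]
  exact h1.add (posSemidef_sum _ fun y _ => posSemidef_conjTranspose_mul_self _)

lemma traceNorm_cqOp_le (τ : κ → Matrix ι ι ℂ) : traceNorm (cqOp τ) ≤ ∑ x, traceNorm (τ x) :=
  traceNorm_le_of_forall fun U hU => by
    rw [trace_eq_sum_block, Complex.re_sum]
    refine Finset.sum_le_sum fun x _ => ?_
    rw [block_mul_cqOp]
    exact trace_mul_re_le_traceNorm (isContraction_block hU x) _

/-- Pinching in the basis of a classical register does not increase the trace norm. -/
lemma sum_traceNorm_block_le (A : Matrix (κ × ι) (κ × ι) ℂ) :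
    ∑ x, traceNorm (block A x) ≤ traceNorm A := by
  choose U hU hUA using fun x => exists_trace_mul_eq_traceNorm (block A x)
  have := trace_mul_re_le_traceNorm (isContraction_cqOp hU) A
  rw [trace_eq_sum_block, Complex.re_sum] at this
  refine le_trans (le_of_eq ?_) this
  refine Finset.sum_congr rfl fun x _ => ?_
  rw [block_cqOp_mul, hUA, Complex.ofReal_re]

/-! ### Decoupling -/

lemma trace_mul_nonneg {A B : Matrix ι ι ℂ} (hA : A.PosSemidef) (hB : B.PosSemidef) :
    0 ≤ (A * B).trace := by
  obtain ⟨C, rfl⟩ : ∃ C : Matrix ι ι ℂ, B = star C * C := by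
    open scoped MatrixOrder in
    exact CStarAlgebra.nonneg_iff_eq_star_mul_self.1 (nonneg_iff_posSemidef.2 hB)
  rw [← Matrix.mul_assoc, Matrix.trace_mul_comm, ← Matrix.mul_assoc]
  exact (hA.mul_mul_conjTranspose_same C).trace_nonneg

/-- A weighted Hilbert–Schmidt bound on the trace norm: expand
`0 ≤ tr ((t - U Δ τ⁻¹) τ (t - U Δ τ⁻¹)ᴴ)` for the optimal contraction `U`. -/
lemma two_mul_traceNorm_le {τ : Matrix ι ι ℂ} (hτ : τ.PosDef) (Δ : Matrix ι ι ℂ) {t : ℝ}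
    (ht : 0 < t) :
    2 * traceNorm Δ ≤ t * τ.trace.re + t⁻¹ * (Δ * τ⁻¹ * Δᴴ).trace.re := by
  obtain ⟨U, hU, hUA⟩ := exists_trace_mul_eq_traceNorm Δ
  have hu : IsUnit τ.det := (Matrix.isUnit_iff_isUnit_det _).1 hτ.isUnit
  have hN1 : τ⁻¹ * τ = 1 := nonsing_inv_mul _ hu
  have hN2 : τ * τ⁻¹ = 1 := mul_nonsing_inv _ hu
  have hNH : (τ⁻¹)ᴴ = τ⁻¹ := hτ.inv.isHermitian.eq
  have h1 := (hτ.posSemidef.mul_mul_conjTranspose_same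
    ((t : ℂ) • 1 - U * Δ * τ⁻¹)).trace_nonneg
  have h2 : ((t : ℂ) • 1 - U * Δ * τ⁻¹) * τ * ((t : ℂ) • 1 - U * Δ * τ⁻¹)ᴴ
      = (t : ℂ) • (t : ℂ) • τ - (t : ℂ) • (U * Δ) - (t : ℂ) • (U * Δ)ᴴ
        + U * (Δ * τ⁻¹ * Δᴴ) * Uᴴ := by
    rw [conjTranspose_sub, conjTranspose_smul, conjTranspose_one, conjTranspose_mul, hNH]
    rw [Matrix.sub_mul, Matrix.smul_mul, Matrix.one_mul, Matrix.mul_assoc _ _ τ, hN1,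
      Matrix.mul_one, Matrix.sub_mul, Matrix.mul_sub, Matrix.mul_sub]
    simp only [Complex.star_def, Complex.conj_ofReal, Matrix.mul_smul, Matrix.smul_mul,
      Matrix.mul_one]
    rw [← Matrix.mul_assoc τ, hN2, Matrix.one_mul, conjTranspose_mul]
    simp only [Matrix.mul_assoc]
    abel
  have h3 : (U * (Δ * τ⁻¹ * Δᴴ) * Uᴴ).trace.re ≤ (Δ * τ⁻¹ * Δᴴ).trace.re := by
    have hP : (Δ * τ⁻¹ * Δᴴ).PosSemidef := hτ.inv.posSemidef.mul_mul_conjTranspose_same Δ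
    have := (Complex.le_def.1 (trace_mul_nonneg hP hU)).1
    rw [Matrix.mul_sub, Matrix.mul_one, trace_sub, Complex.sub_re, Complex.zero_re,
      ← Matrix.mul_assoc, Matrix.trace_mul_comm _ U, ← Matrix.mul_assoc] at this
    linarith
  rw [h2] at h1
  have h4 := (Complex.le_def.1 h1).1
  simp only [trace_add, trace_sub, trace_smul, hUA, trace_conjTranspose, smul_eq_mul,
    Complex.add_re, Complex.sub_re, Complex.re_ofReal_mul, Complex.ofReal_re, Complex.zero_re,
    Complex.star_def, Complex.conj_ofReal] at h4
  have h5 : 2 * traceNorm Δ * t ≤ (t * τ.trace.re + t⁻¹ * (Δ * τ⁻¹ * Δᴴ).trace.re) * t := by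
    have : t⁻¹ * (Δ * τ⁻¹ * Δᴴ).trace.re * t = (Δ * τ⁻¹ * Δᴴ).trace.re := by field_simp
    rw [add_mul, this]; nlinarith
  exact le_of_mul_le_mul_right h5 ht

/-- If `ρ ≤ c τ` then `ρ τ⁻¹ ρ ≤ c ρ`: with `S = c τ - ρ`, the difference times `c` is
`ρ τ⁻¹ S τ⁻¹ ρ + S τ⁻¹ ρ τ⁻¹ S`. -/
lemma trace_mul_inv_mul_le {ρ τ : Matrix ι ι ℂ} (hτ : τ.PosDef) (hρ : ρ.PosSemidef) {c : ℝ}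
    (hc : 0 < c) (h : (c • τ - ρ).PosSemidef) :
    (ρ * τ⁻¹ * ρ).trace.re ≤ c * ρ.trace.re := by
  have hu : IsUnit τ.det := (Matrix.isUnit_iff_isUnit_det _).1 hτ.isUnit
  have hN1 : τ⁻¹ * τ = 1 := nonsing_inv_mul _ hu
  have hN2 : τ * τ⁻¹ = 1 := mul_nonsing_inv _ hu
  have hNH : (τ⁻¹)ᴴ = τ⁻¹ := hτ.inv.isHermitian.eq
  have hρH : ρᴴ = ρ := hρ.isHermitian.eq
  have hSH : (c • τ - ρ)ᴴ = c • τ - ρ := h.isHermitian.eq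
  have h1 := h.mul_mul_conjTranspose_same (ρ * τ⁻¹)
  have h2 := hρ.mul_mul_conjTranspose_same ((c • τ - ρ) * τ⁻¹)
  rw [conjTranspose_mul, hNH, hρH] at h1
  rw [conjTranspose_mul, hNH, hSH] at h2
  have e1 : (c • τ - ρ) * τ⁻¹ = c • 1 - ρ * τ⁻¹ := by
    rw [Matrix.sub_mul, Matrix.smul_mul, hN2]
  have e2 : τ⁻¹ * (c • τ - ρ) = c • 1 - τ⁻¹ * ρ := by
    rw [Matrix.mul_sub, Matrix.mul_smul, hN1]
  have key : ρ * τ⁻¹ * (c • τ - ρ) * (τ⁻¹ * ρ)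
      + (c • τ - ρ) * τ⁻¹ * ρ * (τ⁻¹ * (c • τ - ρ)) = c • (c • ρ - ρ * τ⁻¹ * ρ) := by
    rw [e1, e2, Matrix.mul_assoc ρ τ⁻¹, e2]
    simp only [Matrix.sub_mul, Matrix.mul_sub, Matrix.smul_mul, Matrix.mul_smul, Matrix.one_mul,
      Matrix.mul_one, smul_sub, Matrix.mul_assoc]
    abel
  have h3 := (Complex.le_def.1 (h1.add h2).trace_nonneg).1
  rw [key] at h3
  simp only [trace_smul, trace_sub, Complex.smul_re, Complex.sub_re, Complex.zero_re,
    smul_eq_mul] at h3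
  have := nonneg_of_mul_nonneg_right h3 hc
  linarith

/-- Decoupling: linear combinations of operators `ρ x ≤ c τ` whose coefficient vectors are
orthogonal for different `x` have small trace norm on average. -/
lemma sum_traceNorm_le_of_orthogonal {J X : Type*} [Fintype J] [Fintype X] [DecidableEq X]
    {τ : Matrix ι ι ℂ} (hτ : τ.PosDef) {ρ : X → Matrix ι ι ℂ} (hρ : ∀ x, (ρ x).PosSemidef)
    {c K t : ℝ} (hc : 0 < c) (hK : 0 ≤ K) (ht : 0 < t) (h : ∀ x, (c • τ - ρ x).PosSemidef)
    (hsum : ∑ x, (ρ x).trace.re ≤ 1) (a : J → X → ℝ)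
    (ha0 : ∀ x x', x ≠ x' → ∑ j, a j x * a j x' = 0) (ha1 : ∀ x, ∑ j, a j x * a j x ≤ K) :
    2 * ∑ j, traceNorm (∑ x, a j x • ρ x)
      ≤ t * (Fintype.card J * τ.trace.re) + t⁻¹ * (K * c) := by
  have hH : ∀ j, (∑ x, a j x • ρ x)ᴴ = ∑ x, a j x • ρ x := fun j => by
    rw [conjTranspose_sum]
    refine Finset.sum_congr rfl fun x _ => ?_
    rw [conjTranspose_smul, (hρ x).isHermitian.eq, star_trivial]
  have h1 : ∀ j, 2 * traceNorm (∑ x, a j x • ρ x) ≤ t * τ.trace.re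
      + t⁻¹ * ∑ x, ∑ x', a j x * a j x' * (ρ x * τ⁻¹ * ρ x').trace.re := fun j => by
    have := two_mul_traceNorm_le hτ (∑ x, a j x • ρ x) ht
    rw [hH] at this
    convert this using 3
    simp only [Matrix.sum_mul, Matrix.mul_sum, trace_sum, Complex.re_sum, Matrix.smul_mul,
      Matrix.mul_smul, trace_smul, Complex.smul_re, smul_eq_mul]
    rw [Finset.sum_comm]
    refine Finset.sum_congr rfl fun x _ => ?_
    rw [Finset.mul_sum]
    exact Finset.sum_congr rfl fun x' _ => by ring
  have h2 : ∑ j, ∑ x, ∑ x', a j x * a j x' * (ρ x * τ⁻¹ * ρ x').trace.re ≤ K * c := by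
    calc ∑ j, ∑ x, ∑ x', a j x * a j x' * (ρ x * τ⁻¹ * ρ x').trace.re
        = ∑ x, ∑ x', (∑ j, a j x * a j x') * (ρ x * τ⁻¹ * ρ x').trace.re := by
          rw [Finset.sum_comm]
          refine Finset.sum_congr rfl fun x _ => ?_
          rw [Finset.sum_comm]
          refine Finset.sum_congr rfl fun x' _ => ?_
          rw [Finset.sum_mul]
      _ = ∑ x, (∑ j, a j x * a j x) * (ρ x * τ⁻¹ * ρ x).trace.re := by
          refine Finset.sum_congr rfl fun x _ => ?_
          refine Finset.sum_eq_single x (fun x' _ hx => ?_) (by simp)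
          rw [ha0 x x' hx.symm, zero_mul]
      _ ≤ ∑ x, K * (c * (ρ x).trace.re) := by
          refine Finset.sum_le_sum fun x _ => ?_
          have h0 : 0 ≤ (ρ x * τ⁻¹ * ρ x).trace.re := by
            have := (hτ.inv.posSemidef.mul_mul_conjTranspose_same (ρ x)).trace_nonneg
            rw [(hρ x).isHermitian.eq] at this
            exact (Complex.le_def.1 this).1
          exact mul_le_mul (ha1 x) (trace_mul_inv_mul_le hτ (hρ x) hc (h x)) h0 hK
      _ = K * c * ∑ x, (ρ x).trace.re := by rw [Finset.mul_sum]; simp only [mul_assoc]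
      _ ≤ K * c := mul_le_of_le_one_right (by positivity) hsum
  calc 2 * ∑ j, traceNorm (∑ x, a j x • ρ x)
      = ∑ j, 2 * traceNorm (∑ x, a j x • ρ x) := Finset.mul_sum _ _ _
    _ ≤ ∑ j, (t * τ.trace.re
        + t⁻¹ * ∑ x, ∑ x', a j x * a j x' * (ρ x * τ⁻¹ * ρ x').trace.re) :=
      Finset.sum_le_sum fun j _ => h1 j
    _ = t * (Fintype.card J * τ.trace.re)
        + t⁻¹ * ∑ j, ∑ x, ∑ x', a j x * a j x' * (ρ x * τ⁻¹ * ρ x').trace.re := by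
      rw [Finset.sum_add_distrib, Finset.sum_const, Finset.card_univ, nsmul_eq_mul,
        ← Finset.mul_sum, mul_left_comm]
    _ ≤ _ := by gcongr

end TraceNorm

/-! ### Random linear maps over the field with two elements -/

section Linear

open Matrix

variable {k n : ℕ}

/-- All fibres of `r ↦ r v`, `v ≠ 0`, have the same size. -/
lemma card_mulVec_eq {v : Bits n} (hv : v ≠ 0) (y : Bits k) :
    (Finset.univ.filter fun r : Matrix (Fin k) (Fin n) (ZMod 2) => r *ᵥ v = y).card
      = (Finset.univ.filter fun r : Matrix (Fin k) (Fin n) (ZMod 2) => r *ᵥ v = 0).card := by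
  obtain ⟨i, hi⟩ := Function.ne_iff.1 hv
  have hi1 : v i = 1 := by
    have : ∀ a : ZMod 2, a ≠ 0 → a = 1 := by decide
    exact this _ hi
  set r₀ : Matrix (Fin k) (Fin n) (ZMod 2) := vecMulVec y (Pi.single i 1) with hr₀
  have hr : r₀ *ᵥ v = y := by
    rw [hr₀, vecMulVec_mulVec]
    ext j
    simp [hi1]
  refine Finset.card_bij' (fun r _ => r - r₀) (fun r _ => r + r₀) ?_ ?_ ?_ ?_
  · intro r h
    simp only [Finset.mem_filter, Finset.mem_univ, true_and] at h ⊢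
    rw [sub_mulVec, h, hr, sub_self]
  · intro r h
    simp only [Finset.mem_filter, Finset.mem_univ, true_and] at h ⊢
    rw [add_mulVec, h, hr, zero_add]
  · intro r _; simp
  · intro r _; simp

lemma two_pow_mul_card_mulVec_eq_zero {v : Bits n} (hv : v ≠ 0) :
    2 ^ k * (Finset.univ.filter fun r : Matrix (Fin k) (Fin n) (ZMod 2) => r *ᵥ v = 0).card
      = Fintype.card (Matrix (Fin k) (Fin n) (ZMod 2)) := by
  have h1 := Finset.card_eq_sum_card_fiberwise
    (f := fun r : Matrix (Fin k) (Fin n) (ZMod 2) => r *ᵥ v) (s := Finset.univ)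
    (t := Finset.univ) (fun _ _ => Finset.mem_coe.2 (Finset.mem_univ _))
  rw [Finset.sum_congr rfl fun y _ => card_mulVec_eq hv y] at h1
  rw [← Finset.card_univ, h1, Finset.sum_const, Finset.card_univ, smul_eq_mul]
  simp

/-- The Gilbert–Varshamov bound: if fewer than `2 ^ k` strings have weight at most `d`, some
linear code given by `k` parity checks has minimum distance larger than `d`. -/
lemma exists_parityCheck {d : ℝ}
    (h : (Finset.univ.filter fun v : Bits n => (hammingNorm v : ℝ) ≤ d).card < 2 ^ k) :
    ∃ H : Matrix (Fin k) (Fin n) (ZMod 2),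
      ∀ v : Bits n, v ≠ 0 → (hammingNorm v : ℝ) ≤ d → H *ᵥ v ≠ 0 := by
  by_contra! hcon
  set ball := Finset.univ.filter fun v : Bits n => (hammingNorm v : ℝ) ≤ d with hball
  have hcover : (Finset.univ : Finset (Matrix (Fin k) (Fin n) (ZMod 2))) ⊆
      (ball.filter (· ≠ 0)).biUnion fun v => Finset.univ.filter fun r => r *ᵥ v = 0 := by
    intro H _
    obtain ⟨v, hv0, hvd, hHv⟩ := hcon H
    simp only [Finset.mem_biUnion, Finset.mem_filter, Finset.mem_univ, true_and]
    exact ⟨v, ⟨by simpa [hball] using hvd, hv0⟩, hHv⟩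
  have h1 := (Finset.card_le_card hcover).trans Finset.card_biUnion_le
  have h2 : 2 ^ k * Fintype.card (Matrix (Fin k) (Fin n) (ZMod 2))
      ≤ ball.card * Fintype.card (Matrix (Fin k) (Fin n) (ZMod 2)) := by
    calc 2 ^ k * Fintype.card (Matrix (Fin k) (Fin n) (ZMod 2))
        ≤ 2 ^ k * ∑ v ∈ ball.filter (· ≠ 0), (Finset.univ.filter
            fun r : Matrix (Fin k) (Fin n) (ZMod 2) => r *ᵥ v = 0).card :=
          Nat.mul_le_mul_left _ h1
      _ = ∑ v ∈ ball.filter (· ≠ 0), Fintype.card (Matrix (Fin k) (Fin n) (ZMod 2)) := by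
          rw [Finset.mul_sum]
          exact Finset.sum_congr rfl fun v hv =>
            two_pow_mul_card_mulVec_eq_zero (Finset.mem_filter.1 hv).2
      _ = (ball.filter (· ≠ 0)).card * Fintype.card (Matrix (Fin k) (Fin n) (ZMod 2)) := by
          rw [Finset.sum_const, smul_eq_mul]
      _ ≤ _ := Nat.mul_le_mul_right _ (Finset.card_filter_le _ _)
  have := Nat.le_of_mul_le_mul_right h2 Fintype.card_pos
  omega

end Linear

/-! ### Exponential weights on the Hamming cube -/

section Counting

variable {n : ℕ}

lemma sum_prod_bits (f : Fin n → ZMod 2 → ℝ) :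
    ∑ z : Bits n, ∏ i, f i (z i) = ∏ i, (f i 0 + f i 1) := by
  rw [← Fintype.prod_sum]
  exact Finset.prod_congr rfl fun i _ => Fin.sum_univ_two _

lemma pow_hammingDist (u : ℝ) (x z : Bits n) :
    u ^ hammingDist x z = ∏ i, if z i = x i then 1 else u := by
  rw [hammingDist, Finset.prod_ite, Finset.prod_const_one, one_mul, Finset.prod_const]
  congr 2
  ext i
  simp [eq_comm]

lemma sum_pow_hammingDist (u : ℝ) (x : Bits n) :
    ∑ z : Bits n, u ^ hammingDist x z = (1 + u) ^ n := by
  simp_rw [pow_hammingDist]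
  rw [sum_prod_bits fun i c => if c = x i then 1 else u]
  have : ∀ y : ZMod 2, (if (0 : ZMod 2) = y then (1 : ℝ) else u)
      + (if (1 : ZMod 2) = y then 1 else u) = 1 + u := by
    intro y
    have hy : y = 0 ∨ y = 1 := by revert y; decide
    rcases hy with rfl | rfl
    · simp
    · simp [add_comm]
  simp [this]

/-- A position contributes `2 u` to the weighted count if the centres differ there and `1 + u²`
otherwise. -/
lemma sum_pow_hammingDist_mul (u : ℝ) (x₀ x₁ : Bits n) :
    ∑ z : Bits n, u ^ hammingDist x₀ z * u ^ hammingDist x₁ z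
      = (2 * u) ^ hammingDist x₀ x₁ * (1 + u ^ 2) ^ (n - hammingDist x₀ x₁) := by
  simp_rw [pow_hammingDist u _ _, ← Finset.prod_mul_distrib]
  rw [sum_prod_bits fun i c => (if c = x₀ i then 1 else u) * if c = x₁ i then 1 else u]
  have key : ∀ y y' : ZMod 2,
      ((if (0 : ZMod 2) = y then (1 : ℝ) else u) * (if (0 : ZMod 2) = y' then (1 : ℝ) else u)
      + (if (1 : ZMod 2) = y then 1 else u) * (if (1 : ZMod 2) = y' then (1 : ℝ) else u))
        = if y ≠ y' then 2 * u else 1 + u ^ 2 := by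
    intro y y'
    have h2 : ∀ y : ZMod 2, y = 0 ∨ y = 1 := by decide
    rcases h2 y with rfl | rfl <;> rcases h2 y' with rfl | rfl <;> simp <;> ring
  simp_rw [key]
  rw [Finset.prod_ite, Finset.prod_const, Finset.prod_const]
  congr 2
  have := Finset.card_filter_add_card_filter_not (s := (Finset.univ : Finset (Fin n)))
    (fun i => x₀ i ≠ x₁ i)
  rw [Finset.card_univ, Fintype.card_fin] at this
  rw [hammingDist]
  omega

/-- Size of a Hamming ball. -/
lemma card_ball_le {u : ℝ} (hu0 : 0 < u) (hu1 : u ≤ 1) (d : ℝ) :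
    ((Finset.univ.filter fun v : Bits n => (hammingNorm v : ℝ) ≤ d).card : ℝ)
      ≤ u ^ (-d) * (1 + u) ^ n := by
  rw [← sum_pow_hammingDist u (0 : Bits n), Finset.mul_sum, Finset.card_eq_sum_ones, Nat.cast_sum]
  refine (Finset.sum_le_sum fun v hv => ?_).trans
    (Finset.sum_le_sum_of_subset_of_nonneg (Finset.filter_subset _ _) fun v _ _ => by positivity)
  have hv' := (Finset.mem_filter.1 hv).2
  rw [hammingDist_zero_left, ← Real.rpow_natCast, ← Real.rpow_add hu0, Nat.cast_one]
  exact Real.one_le_rpow_of_pos_of_le_one_of_nonpos hu0 hu1 (by linarith)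

/-- Size of the intersection of two Hamming balls whose centres have distance at least `D`. -/
lemma card_inter_ball_le {u : ℝ} (hu0 : 0 < u) (hu1 : u ≤ 1) (w D : ℝ) (x₀ x₁ : Bits n)
    (hD : D ≤ hammingDist x₀ x₁) :
    ((Finset.univ.filter fun z : Bits n =>
        (hammingDist x₀ z : ℝ) ≤ w ∧ (hammingDist x₁ z : ℝ) ≤ w).card : ℝ)
      ≤ u ^ (-(2 * w)) * (2 * u) ^ D * (1 + u ^ 2) ^ ((n : ℝ) - D) := by
  have hle : hammingDist x₀ x₁ ≤ n := by
    simpa using hammingDist_le_card_fintype (x := x₀) (y := x₁)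
  have h1 : ((Finset.univ.filter fun z : Bits n =>
        (hammingDist x₀ z : ℝ) ≤ w ∧ (hammingDist x₁ z : ℝ) ≤ w).card : ℝ)
      ≤ u ^ (-(2 * w)) * ((2 * u) ^ hammingDist x₀ x₁
          * (1 + u ^ 2) ^ (n - hammingDist x₀ x₁)) := by
    rw [← sum_pow_hammingDist_mul, Finset.mul_sum, Finset.card_eq_sum_ones, Nat.cast_sum]
    refine (Finset.sum_le_sum fun v hv => ?_).trans
      (Finset.sum_le_sum_of_subset_of_nonneg (Finset.filter_subset _ _) fun v _ _ => by positivity)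
    obtain ⟨h0, h1⟩ := (Finset.mem_filter.1 hv).2
    rw [← pow_add, ← Real.rpow_natCast, ← Real.rpow_add hu0, Nat.cast_one]
    apply Real.one_le_rpow_of_pos_of_le_one_of_nonpos hu0 hu1
    push_cast
    linarith
  refine h1.trans ?_
  rw [mul_assoc]
  refine mul_le_mul_of_nonneg_left ?_ (by positivity)
  -- moving the exponent `hammingDist x₀ x₁ - D ≥ 0` from `2u` to `1 + u²` increases the product
  rw [← Real.rpow_natCast, ← Real.rpow_natCast, Nat.cast_sub hle]
  set E : ℝ := (hammingDist x₀ x₁ : ℝ)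
  have e1 : (2 * u) ^ E = (2 * u) ^ D * (2 * u) ^ (E - D) := by
    rw [← Real.rpow_add (by positivity)]; congr 1; ring
  have e2 : (1 + u ^ 2) ^ ((n : ℝ) - D) = (1 + u ^ 2) ^ (E - D) * (1 + u ^ 2) ^ ((n : ℝ) - E) := by
    rw [← Real.rpow_add (by positivity)]; congr 1; ring
  rw [e1, e2, mul_assoc]
  gcongr
  nlinarith [sq_nonneg (1 - u)]

end Counting

/-! ### Probabilities -/

section Probability

lemma toOuterMeasure_bind_le {α β : Type*} (P : PMF α) (f : α → PMF β) (s : Set β) {C : ℝ≥0∞}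
    (h : ∀ a, (f a).toOuterMeasure s ≤ C) : (P.bind f).toOuterMeasure s ≤ C := by
  rw [PMF.toOuterMeasure_bind_apply]
  calc ∑' a, P a * (f a).toOuterMeasure s ≤ ∑' a, P a * C := by gcongr; exact h _
    _ = C := by rw [ENNReal.tsum_mul_right, P.tsum_coe, one_mul]

lemma one_sub_toOuterMeasure_le {α : Type*} (P : PMF α) (s : Set α) :
    1 - P.toOuterMeasure s ≤ P.toOuterMeasure sᶜ := by
  rw [tsub_le_iff_left]
  have h1 : P.toOuterMeasure (s ∪ sᶜ) ≤ P.toOuterMeasure s + P.toOuterMeasure sᶜ :=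
    MeasureTheory.measure_union_le _ _
  rw [Set.union_compl_self] at h1
  refine le_trans (le_of_eq ?_) h1
  exact ((PMF.toOuterMeasure_apply_eq_one_iff P Set.univ).2 (Set.subset_univ _)).symm

lemma toOuterMeasure_eq_ofReal {α : Type*} [Fintype α] (P : PMF α) (s : Set α)
    [DecidablePred (· ∈ s)] :
    P.toOuterMeasure s = ENNReal.ofReal (∑ z with z ∈ s, (P z).toReal) := by
  rw [PMF.toOuterMeasure_apply_fintype, ENNReal.ofReal_sum_of_nonneg
    (fun _ _ => ENNReal.toReal_nonneg), Finset.sum_filter]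
  refine Finset.sum_congr rfl fun z _ => ?_
  rw [Set.indicator_apply]
  split_ifs
  · rw [ENNReal.ofReal_toReal (P.apply_ne_top z)]
  · rfl

/-- The Chernoff bound for the number of flips of the binary symmetric channel. -/
lemma bsc_toOuterMeasure_le {n : ℕ} (θ : Params) (x : Bits n) {v : ℝ} (hv : 1 ≤ v) (w : ℝ) :
    (bsc n θ x).toOuterMeasure {z | w < hammingDist x z}
      ≤ ENNReal.ofReal (v ^ (-w) * (1 - θ.p + θ.p * v) ^ n) := by
  have hp0 := θ.p_pos
  have hp1 := θ.p_lt
  have hv0 : 0 < v := by linarith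
  classical
  rw [toOuterMeasure_eq_ofReal]
  apply ENNReal.ofReal_le_ofReal
  have hval : ∀ z, (bsc n θ x z).toReal = ∏ i, if z i = x i then 1 - θ.p else θ.p := by
    intro z
    rw [bsc, PMF.ofFintype_apply, ENNReal.toReal_prod]
    refine Finset.prod_congr rfl fun i _ => ENNReal.toReal_ofReal ?_
    split_ifs <;> linarith
  have hsum : ∑ z : Bits n, (bsc n θ x z).toReal * v ^ hammingDist x z
      = (1 - θ.p + θ.p * v) ^ n := by
    simp_rw [hval, pow_hammingDist, ← Finset.prod_mul_distrib]
    rw [sum_prod_bits fun i c => (if c = x i then 1 - θ.p else θ.p) * if c = x i then 1 else v]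
    have : ∀ y : ZMod 2, (if (0 : ZMod 2) = y then 1 - θ.p else θ.p)
        * (if (0 : ZMod 2) = y then 1 else v) + (if (1 : ZMod 2) = y then 1 - θ.p else θ.p)
        * (if (1 : ZMod 2) = y then 1 else v) = 1 - θ.p + θ.p * v := by
      intro y
      have hy : y = 0 ∨ y = 1 := by revert y; decide
      rcases hy with rfl | rfl
      · simp
      · simp [add_comm]
    simp only [this, Finset.prod_const, Finset.card_univ, Fintype.card_fin]
  rw [← hsum, Finset.mul_sum]
  refine (Finset.sum_le_sum fun z hz => ?_).trans
    (Finset.sum_le_sum_of_subset_of_nonneg (Finset.filter_subset _ _) fun v _ _ => by positivity)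
  have hz' : w < hammingDist x z := (Finset.mem_filter.1 hz).2
  rw [mul_left_comm]
  refine le_mul_of_one_le_right ENNReal.toReal_nonneg ?_
  rw [← Real.rpow_natCast, ← Real.rpow_add hv0]
  exact Real.one_le_rpow hv (by linarith)

/-- Small sets have small probability under distributions of large smooth min-entropy. -/
lemma toOuterMeasure_le_of_smoothHminC {α : Type*} [Fintype α] (P : PMF α) {ε l : ℝ}
    (h : (l : EReal) ≤ smoothHminC ε fun z => (P z).toReal) (s : Set α) [DecidablePred (· ∈ s)] :
    P.toOuterMeasure s
      ≤ ENNReal.ofReal ((Finset.univ.filter (· ∈ s)).card * (2 : ℝ) ^ (1 - l) + 2 * ε) := by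
  have hlt : ((l - 1 : ℝ) : EReal) < smoothHminC ε fun z => (P z).toReal :=
    lt_of_lt_of_le (by exact_mod_cast sub_one_lt l) h
  simp only [smoothHminC, lt_iSup_iff] at hlt
  obtain ⟨Q, -, hQε, hQ⟩ := hlt
  rw [HminC, EReal.lt_neg_comm, ← EReal.coe_neg] at hQ
  simp only [iInf_lt_iff] at hQ
  obtain ⟨c, hc, hcl⟩ := hQ
  have hcl' : c ≤ 1 - l := by
    have := EReal.coe_lt_coe_iff.1 hcl
    linarith
  rw [toOuterMeasure_eq_ofReal]
  apply ENNReal.ofReal_le_ofReal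
  have h1 : ∑ z, |Q z - (P z).toReal| ≤ 2 * ε := by
    have := abs_nonneg (∑ z, Q z - ∑ z, (P z).toReal)
    rw [gtdC] at hQε
    linarith
  calc ∑ z with z ∈ s, (P z).toReal
      ≤ ∑ z with z ∈ s, ((2 : ℝ) ^ (1 - l) + |Q z - (P z).toReal|) := by
        refine Finset.sum_le_sum fun z _ => ?_
        have h2 := (hc z).trans (Real.rpow_le_rpow_of_exponent_le one_le_two hcl')
        have h3 := neg_abs_le (Q z - (P z).toReal)
        linarith
    _ = (Finset.univ.filter (· ∈ s)).card * (2 : ℝ) ^ (1 - l)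
        + ∑ z with z ∈ s, |Q z - (P z).toReal| := by
        rw [Finset.sum_add_distrib, Finset.sum_const, nsmul_eq_mul]
    _ ≤ _ := by
        gcongr
        exact (Finset.sum_le_sum_of_subset_of_nonneg (Finset.filter_subset _ _)
          fun _ _ _ => abs_nonneg _).trans h1

end Probability

/-! ### Hiding a linear hash -/

section Hiding

open Matrix

variable {n s k : ℕ}

/-- Coefficient of the input `x` in the difference between the conditional operators for the
messages `m` and `m'`, when the commit message is `(q, r, y)`: parity checks `q`, hash matrix `r`
and masked message `y`. -/
def hashCoeff (H : Matrix (Fin s) (Fin n) (ZMod 2)) (m m' : Bits k)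
    (j : Bits s × Matrix (Fin k) (Fin n) (ZMod 2) × Bits k) (x : Bits n) : ℝ :=
  if j.1 = H *ᵥ x then
    (if j.2.2 = m + j.2.1 *ᵥ x then 1 else 0) - (if j.2.2 = m' + j.2.1 *ᵥ x then 1 else 0)
  else 0

/-- Coefficient vectors of different inputs are orthogonal: for `v = x - x'`, the inner product counts
`2 [r v = 0] - [r v = m' - m] - [r v = m - m']`, which cancels on average over `r`. -/
lemma sum_hashCoeff_mul_of_ne (H : Matrix (Fin s) (Fin n) (ZMod 2)) (m m' : Bits k)
    {x x' : Bits n} (hx : x ≠ x') :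
    ∑ j, hashCoeff H m m' j x * hashCoeff H m m' j x' = 0 := by
  have hcnt : ∀ y : Bits k,
      (∑ r : Matrix (Fin k) (Fin n) (ZMod 2), if r *ᵥ (x - x') = y then (1 : ℝ) else 0)
        = ∑ r : Matrix (Fin k) (Fin n) (ZMod 2), if r *ᵥ (x - x') = 0 then (1 : ℝ) else 0 := by
    intro y
    rw [Finset.sum_boole, Finset.sum_boole, card_mulVec_eq (sub_ne_zero.2 hx) y]
  have hin : ∀ r : Matrix (Fin k) (Fin n) (ZMod 2),
      ∑ y : Bits k, ((if y = m + r *ᵥ x then (1 : ℝ) else 0) - (if y = m' + r *ᵥ x then 1 else 0))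
        * ((if y = m + r *ᵥ x' then (1 : ℝ) else 0) - (if y = m' + r *ᵥ x' then 1 else 0))
      = 2 * (if r *ᵥ (x - x') = 0 then (1 : ℝ) else 0)
        - (if r *ᵥ (x - x') = m' - m then (1 : ℝ) else 0)
        - (if r *ᵥ (x - x') = m - m' then (1 : ℝ) else 0) := by
    intro r
    have e : ∀ a b : Bits k, ∑ y : Bits k, (if y = a then (1 : ℝ) else 0)
        * (if y = b then (1 : ℝ) else 0) = if a = b then 1 else 0 := by
      intro a b; simp [eq_comm]
    simp only [sub_mul, mul_sub, Finset.sum_sub_distrib, e]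
    have c1 : ∀ a : Bits k, (a + r *ᵥ x = a + r *ᵥ x') = (r *ᵥ x - r *ᵥ x' = 0) := by
      intro a; rw [add_right_inj, sub_eq_zero]
    have c2 : ∀ a b : Bits k, (a + r *ᵥ x = b + r *ᵥ x') = (r *ᵥ x - r *ᵥ x' = b - a) := by
      intro a b
      rw [eq_iff_iff]
      constructor
      · intro h; rw [sub_eq_sub_iff_add_eq_add, add_comm, h]
      · intro h; rw [sub_eq_sub_iff_add_eq_add] at h; rw [add_comm, h]
    simp only [c1, c2 m m', c2 m' m, mulVec_sub]
    ring
  simp only [Fintype.sum_prod_type, hashCoeff]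
  refine Finset.sum_eq_zero fun q _ => ?_
  by_cases h1 : q = H *ᵥ x
  · by_cases h2 : q = H *ᵥ x'
    · simp only [if_pos h1, if_pos h2, hin, Finset.sum_sub_distrib, ← Finset.mul_sum, hcnt (m - m'),
        hcnt (m' - m)]
      ring
    · simp [h2]
  · simp [h1]

/-- Each parity check value other than `H x` contributes nothing, and for each `r` at most two masked
messages do. -/
lemma sum_hashCoeff_le (H : Matrix (Fin s) (Fin n) (ZMod 2)) (m m' : Bits k) (x : Bits n)
    (f : ℝ → ℝ) (hf0 : f 0 = 0)
    (hf : ∀ (P Q : Prop) [Decidable P] [Decidable Q],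
      f ((if P then 1 else 0) - (if Q then 1 else 0)) ≤ (if P then 1 else 0) + if Q then 1 else 0) :
    ∑ j, f (hashCoeff H m m' j x) ≤ 2 * Fintype.card (Matrix (Fin k) (Fin n) (ZMod 2)) := by
  simp only [Fintype.sum_prod_type, hashCoeff]
  rw [Finset.sum_eq_single (H *ᵥ x) (fun q _ hq => by simp [hq, hf0]) (by simp)]
  simp only [if_true]
  calc ∑ r : Matrix (Fin k) (Fin n) (ZMod 2), ∑ y : Bits k,
        f ((if y = m + r *ᵥ x then 1 else 0) - (if y = m' + r *ᵥ x then 1 else 0))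
      ≤ ∑ r : Matrix (Fin k) (Fin n) (ZMod 2), ∑ y : Bits k,
        ((if y = m + r *ᵥ x then (1 : ℝ) else 0) + (if y = m' + r *ᵥ x then 1 else 0)) :=
        Finset.sum_le_sum fun r _ => Finset.sum_le_sum fun y _ => hf _ _
    _ = ∑ r : Matrix (Fin k) (Fin n) (ZMod 2), (2 : ℝ) := by
        refine Finset.sum_congr rfl fun r _ => ?_
        rw [Finset.sum_add_distrib]
        simp only [Finset.sum_ite_eq', Finset.mem_univ, if_true]
        norm_num
    _ = _ := by rw [Finset.sum_const, Finset.card_univ, nsmul_eq_mul, mul_comm]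

lemma sum_hashCoeff_mul_self_le (H : Matrix (Fin s) (Fin n) (ZMod 2)) (m m' : Bits k)
    (x : Bits n) : ∑ j, hashCoeff H m m' j x * hashCoeff H m m' j x
      ≤ 2 * Fintype.card (Matrix (Fin k) (Fin n) (ZMod 2)) :=
  sum_hashCoeff_le H m m' x (fun a => a * a) (by simp) fun P Q _ _ => by split_ifs <;> norm_num

lemma sum_abs_hashCoeff_le (H : Matrix (Fin s) (Fin n) (ZMod 2)) (m m' : Bits k)
    (x : Bits n) : ∑ j, |hashCoeff H m m' j x|
      ≤ 2 * Fintype.card (Matrix (Fin k) (Fin n) (ZMod 2)) :=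
  sum_hashCoeff_le H m m' x (fun a => |a|) (by simp) fun P Q _ _ => by split_ifs <;> norm_num

lemma block_one_kronecker {ι κ : Type*} [Fintype ι] [DecidableEq ι] [Fintype κ] [DecidableEq κ]
    (σ : Matrix ι ι ℂ) (x : κ) : block ((1 : Matrix κ κ ℂ) ⊗ₖ σ) x = σ := by
  ext i j; simp [block]

/-- What a lower bound on the smooth conditional min-entropy of a classical-quantum state gives:
nearby blocks that are dominated by a common state. The optimal operator need not be
classical-quantum, but its diagonal blocks serve as well. -/
lemma exists_blocks_of_smoothHmin {X B : Type*} [Fintype X] [DecidableEq X] [Fintype B]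
    [DecidableEq B] {ρ : X → Matrix B B ℂ} {ε l : ℝ} (h : (l : EReal) ≤ smoothHmin ε (cqOp ρ)) :
    ∃ (ρ' : X → Matrix B B ℂ) (σ : Matrix B B ℂ), IsState σ ∧ (∀ x, (ρ' x).PosSemidef) ∧
      ∑ x, (ρ' x).trace.re ≤ 1 ∧ (∀ x, ((2 : ℝ) ^ (1 - l) • σ - ρ' x).PosSemidef) ∧
      ∑ x, traceNorm (ρ' x - ρ x) ≤ 2 * ε := by
  have hlt : ((l - 1 : ℝ) : EReal) < smoothHmin ε (cqOp ρ) :=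
    lt_of_lt_of_le (by exact_mod_cast sub_one_lt l) h
  simp only [smoothHmin, Hmin, lt_iSup_iff] at hlt
  obtain ⟨ρ', hρ', hε, σ, hσ, hD⟩ := hlt
  rw [Dmax, EReal.lt_neg_comm, ← EReal.coe_neg] at hD
  simp only [iInf_lt_iff] at hD
  obtain ⟨c, hc, hcl⟩ := hD
  have hcl' : c ≤ 1 - l := by
    have := EReal.coe_lt_coe_iff.1 hcl
    linarith
  refine ⟨block ρ', σ, hσ, fun x => hρ'.1.submatrix _, ?_, fun x => ?_, ?_⟩
  · have := hρ'.2
    rwa [trace_eq_sum_block, Complex.re_sum] at this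
  · have h1 : (block ((2 : ℝ) ^ c • ((1 : Matrix X X ℂ) ⊗ₖ σ) - ρ') x).PosSemidef :=
      hc.submatrix _
    have h2 : (2 : ℝ) ^ (1 - l) • σ - block ρ' x
        = block ((2 : ℝ) ^ c • ((1 : Matrix X X ℂ) ⊗ₖ σ) - ρ') x
          + ((2 : ℝ) ^ (1 - l) - (2 : ℝ) ^ c) • σ := by
      have : block ((2 : ℝ) ^ c • ((1 : Matrix X X ℂ) ⊗ₖ σ) - ρ') x
          = (2 : ℝ) ^ c • block ((1 : Matrix X X ℂ) ⊗ₖ σ) x - block ρ' x := rfl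
      rw [this, block_one_kronecker, sub_smul]
      abel
    rw [h2]
    refine h1.add (hσ.1.smul (sub_nonneg.2 ?_))
    exact Real.rpow_le_rpow_of_exponent_le one_le_two hcl'
  · have h1 := sum_traceNorm_block_le (ρ' - cqOp ρ)
    have h2 := traceNorm_le_two_gtd ρ' (cqOp ρ)
    have h3 : ∀ x, block (ρ' - cqOp ρ) x = block ρ' x - ρ x := fun x => by
      conv_rhs => rw [← block_cqOp ρ x]
      rfl
    simp only [h3] at h1
    linarith

/-- The leftover hash lemma against quantum side information, for a linear hash of a string whose
parity checks `H x` are public. -/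
lemma sum_traceNorm_hashCoeff_le {d : ℕ} (H : Matrix (Fin s) (Fin n) (ZMod 2)) (m m' : Bits k)
    {ρ : Bits n → Matrix (Fin d) (Fin d) ℂ} {ε l : ℝ}
    (h : (l : EReal) ≤ smoothHmin ε (cqOp ρ)) :
    ∑ j, traceNorm (∑ x, hashCoeff H m m' j x • ρ x)
      ≤ Fintype.card (Matrix (Fin k) (Fin n) (ZMod 2))
        * (2 * (2 : ℝ) ^ ((1 - l + s + k) / 2) + 4 * ε) := by
  obtain ⟨ρ', σ, hσ, hρ', htr, hdom, hε⟩ := exists_blocks_of_smoothHmin h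
  set R : ℝ := (Fintype.card (Matrix (Fin k) (Fin n) (ZMod 2)) : ℝ) with hR
  have hR0 : 0 ≤ R := Nat.cast_nonneg _
  -- regularise `σ` to an invertible operator of trace at most two
  set η : ℝ := 1 / (d + 1) with hη
  have hη0 : 0 < η := by positivity
  set τ : Matrix (Fin d) (Fin d) ℂ := η • 1 + σ with hτdef
  have hτ : τ.PosDef := (PosDef.one.smul hη0).add_posSemidef hσ.1
  have hτtr : τ.trace.re ≤ 2 := by
    rw [hτdef, trace_add, trace_smul, hσ.2, trace_one, Fintype.card_fin, Complex.add_re,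
      Complex.smul_re, Complex.natCast_re, Complex.one_re, smul_eq_mul]
    have : η * d ≤ 1 := by
      rw [hη, one_div, inv_mul_le_iff₀ (by positivity)]
      linarith
    linarith
  have hc0 : (0 : ℝ) < 2 ^ (1 - l) := by positivity
  have hdom' : ∀ x, ((2 : ℝ) ^ (1 - l) • τ - ρ' x).PosSemidef := fun x => by
    have : (2 : ℝ) ^ (1 - l) • τ - ρ' x
        = ((2 : ℝ) ^ (1 - l) * η) • (1 : Matrix (Fin d) (Fin d) ℂ)
          + ((2 : ℝ) ^ (1 - l) • σ - ρ' x) := by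
      rw [hτdef, smul_add, smul_smul]; abel
    rw [this]
    exact (PosSemidef.one.smul (by positivity)).add (hdom x)
  set t : ℝ := (2 : ℝ) ^ ((1 - l - s - k) / 2) with ht
  have ht0 : 0 < t := by positivity
  have h1 := sum_traceNorm_le_of_orthogonal hτ hρ' hc0 (by positivity : 0 ≤ 2 * R) ht0 hdom' htr
    (hashCoeff H m m') (fun x x' => sum_hashCoeff_mul_of_ne H m m')
    (sum_hashCoeff_mul_self_le H m m')
  have hcard : (Fintype.card (Bits s × Matrix (Fin k) (Fin n) (ZMod 2) × Bits k) : ℝ)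
      = 2 ^ (s : ℝ) * 2 ^ (k : ℝ) * R := by
    rw [Fintype.card_prod, Fintype.card_prod, Nat.cast_mul, Nat.cast_mul, ← hR]
    simp only [Fintype.card_fun, ZMod.card, Fintype.card_fin, Nat.cast_pow, Nat.cast_ofNat,
      Real.rpow_natCast]
    ring
  have hJ : t * (2 ^ (s : ℝ) * 2 ^ (k : ℝ)) = (2 : ℝ) ^ ((1 - l + s + k) / 2) := by
    rw [ht, ← Real.rpow_add two_pos, ← Real.rpow_add two_pos]; congr 1; ring
  have hJ' : t⁻¹ * (2 : ℝ) ^ (1 - l) = (2 : ℝ) ^ ((1 - l + s + k) / 2) := by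
    rw [ht, ← Real.rpow_neg two_pos.le, ← Real.rpow_add two_pos]; congr 1; ring
  have h2 : ∑ j, traceNorm (∑ x, hashCoeff H m m' j x • ρ' x)
      ≤ R * (2 * (2 : ℝ) ^ ((1 - l + s + k) / 2)) := by
    have h3 : t * ((2 ^ (s : ℝ) * 2 ^ (k : ℝ) * R) * τ.trace.re)
        ≤ t * ((2 ^ (s : ℝ) * 2 ^ (k : ℝ) * R) * 2) := by gcongr
    have h4 : t * ((2 ^ (s : ℝ) * 2 ^ (k : ℝ) * R) * 2)
        = 2 * R * (2 : ℝ) ^ ((1 - l + s + k) / 2) := by rw [← hJ]; ring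
    have h5 : t⁻¹ * (2 * R * (2 : ℝ) ^ (1 - l)) = 2 * R * (2 : ℝ) ^ ((1 - l + s + k) / 2) := by
      rw [← hJ']; ring
    rw [hcard, h5] at h1
    linarith
  -- the smoothing error
  have h6 : ∀ j, traceNorm (∑ x, hashCoeff H m m' j x • ρ x)
      ≤ traceNorm (∑ x, hashCoeff H m m' j x • ρ' x)
        + ∑ x, |hashCoeff H m m' j x| * traceNorm (ρ' x - ρ x) := fun j => by
    have : ∑ x, hashCoeff H m m' j x • ρ x = ∑ x, hashCoeff H m m' j x • ρ' x
        + ∑ x, (-hashCoeff H m m' j x) • (ρ' x - ρ x) := by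
      rw [← Finset.sum_add_distrib]
      refine Finset.sum_congr rfl fun x _ => ?_
      rw [smul_sub, neg_smul, neg_smul]; abel
    rw [this]
    refine (traceNorm_add_le _ _).trans (add_le_add le_rfl ((traceNorm_sum_le _ _).trans ?_))
    refine Finset.sum_le_sum fun x _ => ?_
    rw [← abs_neg]
    exact traceNorm_real_smul_le _ _
  calc ∑ j, traceNorm (∑ x, hashCoeff H m m' j x • ρ x)
      ≤ ∑ j, traceNorm (∑ x, hashCoeff H m m' j x • ρ' x)
        + ∑ j, ∑ x, |hashCoeff H m m' j x| * traceNorm (ρ' x - ρ x) := by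
        rw [← Finset.sum_add_distrib]; exact Finset.sum_le_sum fun j _ => h6 j
    _ ≤ R * (2 * (2 : ℝ) ^ ((1 - l + s + k) / 2)) + 2 * R * (2 * ε) := by
        refine add_le_add h2 ?_
        rw [Finset.sum_comm]
        calc ∑ x, ∑ j, |hashCoeff H m m' j x| * traceNorm (ρ' x - ρ x)
            ≤ ∑ x, 2 * R * traceNorm (ρ' x - ρ x) := by
              refine Finset.sum_le_sum fun x _ => ?_
              rw [← Finset.sum_mul]
              exact mul_le_mul_of_nonneg_right (sum_abs_hashCoeff_le H m m' x)
                (traceNorm_nonneg _)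
          _ ≤ _ := by
              rw [← Finset.mul_sum]
              gcongr
    _ = _ := by ring

end Hiding

/-! ### The protocol -/

section HashProtocol

open Matrix

/-- Symbols of the noiseless channel: parity checks, hash matrix and masked message, and an opened
string. -/
abbrev HashSym (n s k : ℕ) : Type :=
  (Bits s × Matrix (Fin k) (Fin n) (ZMod 2) × Bits k) × Bits n

/-- The commitment protocol. Alice sends a uniform string `x` through the noisy channel. To commit
to `m` she sends the parity checks `H x`, a uniform matrix `r` and `m + r x`; to reveal, she sends
`x`. Bob accepts if the parity checks agree and `x` has distance at most `w` from the channel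
output. A symbol of the noiseless channel has room for both of Alice's messages, and the unused
part is zero. -/
def hashProtocol {n s : ℕ} (k : ℕ) (H : Matrix (Fin s) (Fin n) (ZMod 2)) (w : ℝ) :
    Protocol n (Bits k) where
  Sym := HashSym n s k
  CoinA := Bits n × Matrix (Fin k) (Fin n) (ZMod 2)
  CoinB := Unit
  CoinR := Unit
  coinA := PMF.uniformOfFintype _
  coinB := PMF.pure ()
  coinR := PMF.pure ()
  pre := []
  post := [Party.alice]
  reveal := [Party.alice]
  aliceMsg := fun m a t =>
    if t = [] then ((H *ᵥ a.1, a.2, m + a.2 *ᵥ a.1), 0) else (0, a.1)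
  aliceInput := fun _ a _ => a.1
  bobPre := fun _ _ => 0
  bobPost := fun _ _ _ => 0
  bobReveal := fun _ _ _ _ => 0
  bobOut := fun _ _ z t =>
    match t with
    | [c, v] => (c.1.2.2 - c.1.2.1 *ᵥ v.2,
        decide ((hammingDist v.2 z : ℝ) ≤ w ∧ c.1.1 = H *ᵥ v.2))
    | _ => (0, false)

variable {n s k : ℕ} (θ : Params) (H : Matrix (Fin s) (Fin n) (ZMod 2)) (w : ℝ)

lemma toOuterMeasure_bind_pure {α β : Type*} (P : PMF α) (f : α → β) (A : Set β) :
    (P.bind fun z => PMF.pure (f z)).toOuterMeasure A = P.toOuterMeasure (f ⁻¹' A) :=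
  PMF.toOuterMeasure_map_apply f P A

lemma deltaC_hashProtocol_le {C : ℝ≥0∞}
    (hC : ∀ x : Bits n, (bsc n θ x).toOuterMeasure {z | w < hammingDist x z} ≤ C) :
    deltaC θ (hashProtocol k H w) ≤ C := by
  refine iSup_le fun m => (one_sub_toOuterMeasure_le _ _).trans ?_
  refine toOuterMeasure_bind_le _ _ _ fun a => toOuterMeasure_bind_le _ _ _ fun b => ?_
  have : ∀ (F : Bits n → Bits k × Bool),
      ((bsc n θ a.1).bind fun z => (PMF.pure ()).bind fun _ : Unit => PMF.pure (F z))
        = (bsc n θ a.1).bind fun z => PMF.pure (F z) := by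
    intro F; simp only [PMF.pure_bind]
  refine le_trans ?_ (hC a.1)
  refine (le_of_eq (congrArg (fun P : PMF (Bits k × Bool) => P.toOuterMeasure {(m, true)}ᶜ)
    (this _))).trans ?_
  rw [toOuterMeasure_bind_pure]
  refine MeasureTheory.measure_mono fun z hz => ?_
  by_contra hzw
  apply hz
  simp only [Set.mem_ofPred_eq, not_lt] at hzw
  simp [hashProtocol, run, hzw]

/-- Neither of Alice's openings depends on the channel output, since Bob is silent. Two different
accepted openings differ by an element of the code, hence are far apart. -/
lemma deltaB_hashProtocol_le {D : ℝ}
    (hH : ∀ v : Bits n, v ≠ 0 → (hammingNorm v : ℝ) ≤ D → H *ᵥ v ≠ 0) {C : ℝ≥0∞}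
    (hC : ∀ P : PMF (Bits n), (θ.lA : EReal) ≤ smoothHminC θ.epsA (fun z => (P z).toReal) →
      ∀ x₀ x₁ : Bits n, D ≤ hammingDist x₀ x₁ →
        P.toOuterMeasure {z | (hammingDist x₀ z : ℝ) ≤ w ∧ (hammingDist x₁ z : ℝ) ≤ w} ≤ C) :
    deltaB θ (hashProtocol k H w) ≤ C := by
  refine iSup_le fun S => ?_
  refine toOuterMeasure_bind_le _ _ _ fun a => toOuterMeasure_bind_le _ _ _ fun b => ?_
  let c : HashSym n s k := S.msg a []
  let v₀ : HashSym n s k := S.reveal₀ a [c]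
  let v₁ : HashSym n s k := S.reveal₁ a [c]
  have key : ∀ (P : PMF (Bits n)) (F G : Bits n → Bits k × Bool),
      (P.bind fun z => (PMF.pure ()).bind fun _ : Unit => (PMF.pure ()).bind fun _ : Unit =>
        PMF.pure (F z, G z)) = P.bind fun z => PMF.pure (F z, G z) := by
    intro P F G; simp only [PMF.pure_bind]
  refine (le_of_eq (congrArg (fun P : PMF ((Bits k × Bool) × (Bits k × Bool)) =>
    P.toOuterMeasure {o | o.1.2 = true ∧ o.2.2 = true ∧ o.1.1 ≠ o.2.1}) (key _ _ _))).trans ?_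
  rw [toOuterMeasure_bind_pure]
  have hset : ∀ z : Bits n,
      ((c.1.2.2 - c.1.2.1 *ᵥ v₀.2,
          decide ((hammingDist v₀.2 z : ℝ) ≤ w ∧ c.1.1 = H *ᵥ v₀.2)),
        (c.1.2.2 - c.1.2.1 *ᵥ v₁.2,
          decide ((hammingDist v₁.2 z : ℝ) ≤ w ∧ c.1.1 = H *ᵥ v₁.2)))
        ∈ {o : (Bits k × Bool) × (Bits k × Bool) |
            o.1.2 = true ∧ o.2.2 = true ∧ o.1.1 ≠ o.2.1} →
      z ∈ {z | (hammingDist v₀.2 z : ℝ) ≤ w ∧ (hammingDist v₁.2 z : ℝ) ≤ w} ∧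
        D ≤ hammingDist v₀.2 v₁.2 := by
    intro z hz
    simp only [Set.mem_ofPred_eq, decide_eq_true_eq] at hz
    obtain ⟨⟨h0, h0'⟩, ⟨h1, h1'⟩, hne⟩ := hz
    refine ⟨⟨h0, h1⟩, ?_⟩
    by_contra! hlt
    refine hH (v₀.2 - v₁.2) ?_ ?_ ?_
    · intro h; exact hne (by rw [sub_eq_zero.1 h])
    · rw [sub_eq_neg_add, ← hammingDist_eq_hammingNorm, hammingDist_comm]; exact hlt.le
    · rw [mulVec_sub, ← h0', ← h1', sub_self]
  by_cases hD : D ≤ hammingDist v₀.2 v₁.2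
  · refine le_trans (MeasureTheory.measure_mono fun z hz => (hset z hz).1)
      (hC _ (S.W_constraint _) v₀.2 v₁.2 hD)
  · refine le_trans (MeasureTheory.measure_mono (t := ∅) fun z hz => hD (hset z hz).2) ?_
    simp

lemma deltaH_hashProtocol_le :
    deltaH θ (hashProtocol k H w)
      ≤ ENNReal.ofReal (2 * (2 : ℝ) ^ ((1 - θ.lB + s + k) / 2) + 4 * θ.epsB) := by
  refine iSup_le fun S => iSup_le fun m => iSup_le fun m' => iSup_le fun _ => ?_
  apply ENNReal.ofReal_le_ofReal
  refine (gtd_le_traceNorm _ _).trans ?_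
  set R : ℝ := (Fintype.card (Matrix (Fin k) (Fin n) (ZMod 2)) : ℝ) with hR
  have hR0 : 0 < R := Nat.cast_pos.2 Fintype.card_pos
  set δ := 2 * (2 : ℝ) ^ ((1 - θ.lB + s + k) / 2) + 4 * θ.epsB with hδ
  let Φ : Protocol n (Bits k) := hashProtocol k H w
  -- the state conditioned on the coins `c`, and jointly with the commit message `σ`
  let E : Bits k → S.Coin → HashSym n s k → Matrix (Fin S.d) (Fin S.d) ℂ := fun m c σ =>
    ∑ a : Bits n × Matrix (Fin k) (Fin n) (ZMod 2),
      (PMF.uniformOfFintype (Bits n × Matrix (Fin k) (Fin n) (ZMod 2)) a).toReal •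
      if [σ] = [(((H *ᵥ a.1, a.2, m + a.2 *ᵥ a.1), (0 : Bits n)) : HashSym n s k)] then S.W c [] a.1 else 0
  let i₀ : Fin (Φ.pre.length + Φ.post.length) := ⟨0, Nat.one_pos⟩
  have hstate : ∀ m, bobState S m
      = cqOp fun ct => (S.coin ct.1).toReal • E m ct.1 (ct.2 i₀) := by
    intro m; rfl
  have hE : ∀ m c q r y v, E m c ((q, r, y), v) = R⁻¹ • ∑ x : Bits n,
      (if v = 0 ∧ q = H *ᵥ x ∧ y = m + r *ᵥ x then (1 : ℝ) else 0) •
        (((2 : ℝ) ^ n)⁻¹ • S.W c [] x) := by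
    intro m c q r y v
    have hcard : ∀ a, (PMF.uniformOfFintype (Bits n × Matrix (Fin k) (Fin n) (ZMod 2)) a).toReal
        = R⁻¹ * ((2 : ℝ) ^ n)⁻¹ := by
      intro a
      rw [PMF.uniformOfFintype_apply, ENNReal.toReal_inv, ENNReal.toReal_natCast,
        Fintype.card_prod, Nat.cast_mul, mul_inv, ← hR, mul_comm]
      simp
    simp only [E, hcard]
    rw [Fintype.sum_prod_type, Finset.smul_sum]
    refine Finset.sum_congr rfl fun x _ => ?_
    rw [Finset.sum_eq_single r]
    · simp only [List.cons.injEq, Prod.mk.injEq, and_true, true_and]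
      by_cases h1 : v = 0
      · by_cases h2 : q = H *ᵥ x ∧ y = m + r *ᵥ x
        · simp [h1, h2, mul_smul]
        · simp [h1, h2]
      · simp [h1]
    · intro r' _ hr'; simp [hr'.symm]
    · simp
  have hdiff : ∀ c q r y v, E m c ((q, r, y), v) - E m' c ((q, r, y), v)
      = if v = 0 then R⁻¹ • ∑ x : Bits n, hashCoeff H m m' (q, r, y) x •
          (((2 : ℝ) ^ n)⁻¹ • S.W c [] x) else 0 := by
    intro c q r y v
    rw [hE, hE, ← smul_sub, ← Finset.sum_sub_distrib]
    by_cases h1 : v = 0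
    · rw [if_pos h1]
      congr 1
      refine Finset.sum_congr rfl fun x _ => ?_
      rw [← sub_smul]
      congr 1
      by_cases h2 : q = H *ᵥ x
      · simp [hashCoeff, h1, h2]
      · simp [hashCoeff, h2]
    · simp [h1]
  have hc : ∀ c, ∑ σ : HashSym n s k, traceNorm (E m c σ - E m' c σ) ≤ δ := by
    intro c
    have h1 := sum_traceNorm_hashCoeff_le H m m' (S.W_constraint c []).2
    have h2 : ∑ σ : HashSym n s k, traceNorm (E m c σ - E m' c σ)
        = ∑ j : Bits s × Matrix (Fin k) (Fin n) (ZMod 2) × Bits k, traceNorm (R⁻¹ •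
          ∑ x : Bits n, hashCoeff H m m' j x • (((2 : ℝ) ^ n)⁻¹ • S.W c [] x)) := by
      refine (Fintype.sum_prod_type (γ := ℝ)
        (α₁ := Bits s × Matrix (Fin k) (Fin n) (ZMod 2) × Bits k) (α₂ := Bits n)
        (fun σ => traceNorm (E m c σ - E m' c σ))).trans ?_
      refine Finset.sum_congr rfl fun j _ => ?_
      obtain ⟨q, r, y⟩ := j
      rw [Finset.sum_eq_single (0 : Bits n)]
      · rw [hdiff c q r y 0, if_pos rfl]
      · intro v _ hv; rw [hdiff c q r y v, if_neg hv, traceNorm_zero]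
      · simp
    rw [h2]
    calc _ ≤ ∑ j : Bits s × Matrix (Fin k) (Fin n) (ZMod 2) × Bits k, R⁻¹ * traceNorm (
          ∑ x : Bits n, hashCoeff H m m' j x • (((2 : ℝ) ^ n)⁻¹ • S.W c [] x)) := by
          refine Finset.sum_le_sum fun j _ => (traceNorm_real_smul_le _ _).trans ?_
          rw [abs_of_pos (inv_pos.2 hR0)]
      _ ≤ R⁻¹ * (R * δ) := by rw [← Finset.mul_sum]; gcongr
      _ = δ := by field_simp
  rw [hstate, hstate, cqOp_sub]
  refine (traceNorm_cqOp_le _).trans ?_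
  rw [Fintype.sum_prod_type]
  have hcoin : ∑ c, (S.coin c).toReal = 1 := by
    have := S.coin.tsum_coe
    rw [tsum_fintype] at this
    rw [← ENNReal.toReal_sum fun c _ => S.coin.apply_ne_top c, this, ENNReal.toReal_one]
  calc ∑ c, ∑ t : Fin (Φ.pre.length + Φ.post.length) → Φ.Sym,
        traceNorm ((S.coin c).toReal • E m c (t i₀) - (S.coin c).toReal • E m' c (t i₀))
      ≤ ∑ c, (S.coin c).toReal * δ := by
        refine Finset.sum_le_sum fun c _ => ?_
        have h1 : ∑ t : Fin (Φ.pre.length + Φ.post.length) → Φ.Sym,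
            traceNorm ((S.coin c).toReal • E m c (t i₀) - (S.coin c).toReal • E m' c (t i₀))
            = ∑ σ : HashSym n s k,
            traceNorm ((S.coin c).toReal • E m c σ - (S.coin c).toReal • E m' c σ) :=
          (Equiv.funUnique (Fin 1) (HashSym n s k)).sum_comp fun σ =>
            traceNorm ((S.coin c).toReal • E m c σ - (S.coin c).toReal • E m' c σ)
        rw [h1]
        calc _ ≤ ∑ σ : HashSym n s k, (S.coin c).toReal * traceNorm (E m c σ - E m' c σ) := by
              refine Finset.sum_le_sum fun σ _ => ?_
              rw [← smul_sub]
              refine (traceNorm_real_smul_le _ _).trans ?_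
              rw [abs_of_nonneg ENNReal.toReal_nonneg]
          _ ≤ _ := by
              rw [← Finset.mul_sum]
              exact mul_le_mul_of_nonneg_left (hc c) ENNReal.toReal_nonneg
    _ = δ := by rw [← Finset.sum_mul, hcoin, one_mul]

end HashProtocol

/-! ### Entropic exponents -/

section Exponents

lemma h_eq_logb (x : ℝ) : h x = -x * Real.logb 2 x - (1 - x) * Real.logb 2 (1 - x) := by
  rw [h, Real.binEntropy_eq_negMulLog_add_negMulLog_one_sub, Real.negMulLog, Real.negMulLog,
    Real.logb, Real.logb]
  ring

lemma continuous_h : Continuous h := Real.binEntropy_continuous.div_const _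

lemma h_le_one (x : ℝ) : h x ≤ 1 := by
  rw [h, div_le_one (Real.log_pos one_lt_two)]
  exact Real.binEntropy_le_log_two

lemma h_half : h (1 / 2) = 1 := by
  rw [h, one_div, Real.binEntropy_two_inv, div_self (Real.log_pos one_lt_two).ne']

lemma h_nonneg {x : ℝ} (h0 : 0 ≤ x) (h1 : x ≤ 1) : 0 ≤ h x :=
  div_nonneg (Real.binEntropy_nonneg h0 h1) (Real.log_pos one_lt_two).le

/-- `g p` is onto `[2p, h p]`, so that `gInv` is a genuine preimage. -/
lemma gInv_spec {p ξ : ℝ} (hp0 : 0 < p) (hp1 : p < 1 / 2) (hξ : ξ ∈ Set.Icc (2 * p) (h p)) :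
    gInv p ξ ∈ Set.Icc 0 p ∧ g p (gInv p ξ) = ξ := by
  have hcont : ContinuousOn (g p) (Set.Icc 0 p) := by
    unfold g
    have h1 : ContinuousOn (fun σ : ℝ => (p - σ) / (1 - 2 * σ)) (Set.Icc 0 p) := by
      refine ContinuousOn.div (by fun_prop) (by fun_prop) fun σ hσ => ?_
      have := hσ.2
      linarith
    exact ((by fun_prop : ContinuousOn (fun σ : ℝ => 1 - 2 * σ) _).mul
      (continuous_h.comp_continuousOn h1)).add (by fun_prop)
  have h0 : g p 0 = h p := by simp [g]
  have h1 : g p p = 2 * p := by simp [g, h]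
  have hex : ∃ σ ∈ Set.Icc 0 p, g p σ = ξ := by
    have := intermediate_value_Icc' hp0.le hcont
    rw [h0, h1] at this
    exact this hξ
  exact ⟨Function.invFunOn_mem hex, Function.invFunOn_eq hex⟩

/-- Exponent of the weighted count of strings within distance `p n` of two centres at distance
`2 σ n`, with weight parameter `u`. -/
def pairExponent (p σ u : ℝ) : ℝ :=
  -2 * p * Real.logb 2 u + 2 * σ * Real.logb 2 (2 * u) + (1 - 2 * σ) * Real.logb 2 (1 + u ^ 2)

/-- Optimising the weight parameter at distance `2 σ n` gives the exponent `g p σ`; at larger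
distances `2 σ' n`, the exponent is strictly smaller. -/
lemma exists_pairExponent_lt {p σ σ' : ℝ} (hp1 : p < 1 / 2) (hσ0 : 0 ≤ σ) (hσp : σ ≤ p)
    (hσ' : σ < σ') : ∃ u, 0 < u ∧ u < 1 ∧ pairExponent p σ' u < g p σ := by
  rcases hσp.lt_or_eq with hlt | rfl
  · set t := (p - σ) / (1 - 2 * σ) with ht
    have hden : 0 < 1 - 2 * σ := by linarith
    have ht0 : 0 < t := div_pos (by linarith) hden
    have ht1 : t < 1 / 2 := by rw [ht, div_lt_iff₀ hden]; linarith
    have ht1' : 0 < 1 - t := by linarith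
    have htp : p - σ = t * (1 - 2 * σ) := (div_mul_cancel₀ _ hden.ne').symm
    have hq0 : 0 < t / (1 - t) := div_pos ht0 ht1'
    have hq1 : t / (1 - t) < 1 := by rw [div_lt_one ht1']; linarith
    set u := √(t / (1 - t)) with hu
    have hu0 : 0 < u := Real.sqrt_pos.2 hq0
    have hu1 : u < 1 := by rw [hu, Real.sqrt_lt' one_pos]; simpa using hq1
    have husq : u ^ 2 = t / (1 - t) := Real.sq_sqrt hq0.le
    have hlu : 2 * Real.logb 2 u = Real.logb 2 t - Real.logb 2 (1 - t) := by
      rw [← Real.logb_div ht0.ne' ht1'.ne', ← husq, Real.logb_pow]; norm_num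
    have hl1 : Real.logb 2 (1 + u ^ 2) = -Real.logb 2 (1 - t) := by
      rw [husq, ← Real.logb_inv]; congr 1; field_simp; ring
    have hl2 : Real.logb 2 (2 * u) = 1 + Real.logb 2 u := by
      rw [Real.logb_mul two_ne_zero hu0.ne', Real.logb_self_eq_one one_lt_two]
    have hopt : pairExponent p σ u = g p σ := by
      rw [pairExponent, hl1, hl2, g, ← ht, h_eq_logb]
      linear_combination (σ - p) * hlu + (-(Real.logb 2 t) + Real.logb 2 (1 - t)) * htp
    refine ⟨u, hu0, hu1, ?_⟩
    rw [← hopt, pairExponent, pairExponent]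
    have hmono : Real.logb 2 (2 * u) < Real.logb 2 (1 + u ^ 2) := by
      apply Real.logb_lt_logb one_lt_two (by positivity)
      nlinarith [mul_pos (sub_pos.2 hu1) (sub_pos.2 hu1)]
    nlinarith [mul_pos (sub_pos.2 hσ') (sub_pos.2 hmono)]
  · -- here `g σ σ = 2 σ`, and small `u` make the exponent arbitrarily negative
    set N : ℝ := (σ' + 1) / (σ' - σ) with hN
    have hpos : 0 < σ' - σ := sub_pos.2 hσ'
    have hN0 : 0 < N := div_pos (by linarith) hpos
    have hNmul : (σ' - σ) * N = σ' + 1 := by rw [hN]; field_simp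
    set u : ℝ := (2 : ℝ) ^ (-N) with hu
    have hu0 : 0 < u := by positivity
    have hu1 : u < 1 := Real.rpow_lt_one_of_one_lt_of_neg one_lt_two (by linarith)
    have hlu : Real.logb 2 u = -N := Real.logb_rpow two_pos (by norm_num)
    have hl2 : Real.logb 2 (2 * u) = 1 - N := by
      rw [Real.logb_mul two_ne_zero hu0.ne', Real.logb_self_eq_one one_lt_two, hlu]; ring
    have hl1 : Real.logb 2 (1 + u ^ 2) ≤ 1 := by
      have := Real.logb_le_logb_of_le one_lt_two (by positivity) (by nlinarith : 1 + u ^ 2 ≤ 2)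
      rwa [Real.logb_self_eq_one one_lt_two] at this
    have hl0 : 0 ≤ Real.logb 2 (1 + u ^ 2) := Real.logb_nonneg one_lt_two (by nlinarith)
    have hg : g σ σ = 2 * σ := by simp [g, h]
    refine ⟨u, hu0, hu1, ?_⟩
    rw [hg, pairExponent, hlu, hl2]
    nlinarith [mul_nonneg (hσ0.trans hσ'.le) hl0]

lemma rpow_eq_two_rpow {a : ℝ} (ha : 0 < a) (x : ℝ) :
    a ^ x = (2 : ℝ) ^ (x * Real.logb 2 a) := by
  conv_lhs => rw [← Real.rpow_logb two_pos (by norm_num) ha]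
  rw [← Real.rpow_mul two_pos.le, mul_comm]

lemma card_inter_ball_le_two_rpow {n : ℕ} {u : ℝ} (hu0 : 0 < u) (hu1 : u ≤ 1) (p σ : ℝ)
    (x₀ x₁ : Bits n) (hD : 2 * σ * n ≤ hammingDist x₀ x₁) :
    ((Finset.univ.filter fun z : Bits n =>
        (hammingDist x₀ z : ℝ) ≤ p * n ∧ (hammingDist x₁ z : ℝ) ≤ p * n).card : ℝ)
      ≤ (2 : ℝ) ^ (n * pairExponent p σ u) := by
  refine (card_inter_ball_le hu0 hu1 _ _ x₀ x₁ hD).trans (le_of_eq ?_)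
  rw [rpow_eq_two_rpow hu0, rpow_eq_two_rpow (by positivity : 0 < 2 * u),
    rpow_eq_two_rpow (by positivity : 0 < 1 + u ^ 2), ← Real.rpow_add two_pos,
    ← Real.rpow_add two_pos, pairExponent]
  congr 1
  ring

lemma card_ball_le_two_rpow {n : ℕ} {ρ : ℝ} (h0 : 0 < ρ) (h1 : ρ ≤ 1 / 2) :
    ((Finset.univ.filter fun v : Bits n => (hammingNorm v : ℝ) ≤ ρ * n).card : ℝ)
      ≤ (2 : ℝ) ^ (n * h ρ) := by
  have h1' : 0 < 1 - ρ := by linarith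
  have hu0 : 0 < ρ / (1 - ρ) := div_pos h0 h1'
  refine (card_ball_le hu0 ((div_le_one h1').2 (by linarith)) _).trans (le_of_eq ?_)
  rw [← Real.rpow_natCast, rpow_eq_two_rpow hu0, rpow_eq_two_rpow (by positivity : 0 < 1 + ρ / (1 - ρ)),
    ← Real.rpow_add two_pos, h_eq_logb, Real.logb_div h0.ne' h1'.ne']
  have : Real.logb 2 (1 + ρ / (1 - ρ)) = -Real.logb 2 (1 - ρ) := by
    rw [← Real.logb_inv]; congr 1; field_simp; ring
  rw [this]
  congr 1
  ring

/-- The base of the Chernoff bound for exceeding the expected number `p n` of flips by `δ n`. -/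
lemma exists_chernoff_base {p δ : ℝ} (hp : 0 < p) (hδ : 0 < δ) :
    ∃ v : ℝ, 1 ≤ v ∧ 0 ≤ v ^ (-(p + δ)) * (1 - p + p * v) ∧
      v ^ (-(p + δ)) * (1 - p + p * v) < 1 := by
  set v := 1 + δ / (2 * p) with hv
  have hv0 : 0 < v := by positivity
  have hb : 1 - p + p * v = 1 + δ / 2 := by rw [hv]; field_simp; ring
  refine ⟨v, by rw [hv]; linarith [div_pos hδ (by positivity : 0 < 2 * p)], ?_, ?_⟩
  · rw [hb]; positivity
  · rw [hb, Real.rpow_neg hv0.le, inv_mul_lt_iff₀ (by positivity), mul_one,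
      Real.lt_rpow_iff_log_lt (by positivity) hv0]
    have h1 : Real.log (1 + δ / 2) ≤ δ / 2 := by
      have := Real.log_le_sub_one_of_pos (by positivity : 0 < 1 + δ / 2)
      linarith
    have h2 : δ / (2 * p + δ) ≤ Real.log v := by
      have := Real.one_sub_inv_le_log_of_pos hv0
      have e : 1 - v⁻¹ = δ / (2 * p + δ) := by rw [hv]; field_simp; ring
      rwa [e] at this
    calc Real.log (1 + δ / 2) ≤ δ / 2 := h1
      _ < (p + δ) * (δ / (2 * p + δ)) := by
        rw [← mul_div_assoc, div_lt_div_iff₀ (by positivity) (by positivity)]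
        nlinarith [mul_pos hδ hδ]
      _ ≤ (p + δ) * Real.log v := by gcongr

lemma tendsto_two_rpow_sub_mul (c : ℝ) {γ : ℝ} (hγ : 0 < γ) :
    Tendsto (fun n : ℕ => (2 : ℝ) ^ (c - γ * n)) atTop (𝓝 0) := by
  have h1 : ∀ n : ℕ, (2 : ℝ) ^ (c - γ * n) = (2 : ℝ) ^ c * ((2 : ℝ) ^ (-γ)) ^ n := by
    intro n
    rw [← Real.rpow_natCast, ← Real.rpow_mul two_pos.le, ← Real.rpow_add two_pos]
    congr 1
    ring
  simp_rw [h1]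
  have := (tendsto_pow_atTop_nhds_zero_of_lt_one (by positivity)
    (Real.rpow_lt_one_of_one_lt_of_neg one_lt_two (neg_neg_of_pos hγ))).const_mul ((2 : ℝ) ^ c)
  simpa using this

lemma eventually_mul_le_of_liminf {a : ℕ → ℝ} {ξ b : ℝ}
    (ha : liminf (fun n : ℕ => ((a n / (n : ℝ) : ℝ) : EReal)) atTop = (ξ : EReal)) (hb : b < ξ) :
    ∀ᶠ n : ℕ in atTop, b * n ≤ a n := by
  have h1 : (b : EReal) < liminf (fun n : ℕ => ((a n / (n : ℝ) : ℝ) : EReal)) atTop := by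
    rw [ha]; exact_mod_cast hb
  filter_upwards [eventually_lt_of_lt_liminf h1, eventually_gt_atTop 0] with n hn hn0
  have h2 : b < a n / n := by exact_mod_cast hn
  have : (0 : ℝ) < n := by exact_mod_cast hn0
  exact ((lt_div_iff₀ this).1 h2).le

end Exponents

end UsNC
end

theorem theorem2 (p : ℝ) (θ : ℕ → UsNC.Params) (hp : ∀ n, (θ n).p = p) (ξA ξB : ℝ)
    (hepsA : Tendsto (fun n => (θ n).epsA) atTop (𝓝 0))
    (hepsB : Tendsto (fun n => (θ n).epsB) atTop (𝓝 0))
    (hlA : liminf (fun n : ℕ => (((θ n).lA / (n : ℝ) : ℝ) : EReal)) atTop = (ξA : EReal))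
    (hξA : ξA ∈ Set.Icc (2 * p) (UsNC.h p))
    (hlB : liminf (fun n : ℕ => (((θ n).lB / (n : ℝ) : ℝ) : EReal)) atTop = (ξB : EReal))
    (hξB : ξB ∈ Set.Icc 0 (UsNC.h p))
    (hσ : UsNC.gInv p ξA ≤ 1 / 4) :
    UsNC.Achievable θ (ξB - UsNC.h (2 * UsNC.gInv p ξA)) := by
  intro R' hR0 hR
  have hp0 : 0 < p := hp 0 ▸ (θ 0).p_pos
  have hp1 : p < 1 / 2 := hp 0 ▸ (θ 0).p_lt
  obtain ⟨⟨hσ0, hσp⟩, hgσ⟩ := UsNC.gInv_spec hp0 hp1 hξA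
  set σ := UsNC.gInv p ξA
  -- at `σ = 1/4` there is no rate below `ξB - 1`, which is not positive
  have hσlt : σ < 1 / 4 := by
    refine lt_of_le_of_ne hσ fun h4 => ?_
    have h1 : 2 * σ = 1 / 2 := by rw [h4]; norm_num
    rw [h1, UsNC.h_half] at hR
    linarith [hξB.2, UsNC.h_le_one p]
  obtain ⟨σ', hσ'R, hσ'1, hσσ'⟩ : ∃ σ', R' + UsNC.h (2 * σ') < ξB ∧ σ' < 1 / 4 ∧ σ < σ' := by
    have hc : ContinuousAt (fun x => R' + UsNC.h (2 * x)) σ :=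
      (continuous_const.add (UsNC.continuous_h.comp (continuous_const.mul continuous_id))).continuousAt
    have e1 := hc.eventually_lt_const (by linarith : R' + UsNC.h (2 * σ) < ξB)
    have e2 := eventually_lt_nhds hσlt
    exact ((e1.and e2).filter_mono nhdsWithin_le_nhds |>.and
      (self_mem_nhdsWithin (a := σ) (s := Set.Ioi σ))).exists.imp fun x hx => ⟨hx.1.1, hx.1.2, hx.2⟩
  have hσ'0 : 0 < σ' := by linarith
  have hρ : 0 ≤ UsNC.h (2 * σ') := UsNC.h_nonneg (by linarith) (by linarith)
  obtain ⟨u, hu0, hu1, hu⟩ := UsNC.exists_pairExponent_lt hp1 hσ0 hσp hσσ'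
  rw [hgσ] at hu
  -- the slack `δ` in Bob's distance test
  obtain ⟨δ, hδ, hδ0⟩ : ∃ δ, UsNC.pairExponent (p + δ) σ' u < ξA ∧ 0 < δ := by
    have hc : ContinuousAt (fun x => UsNC.pairExponent (p + x) σ' u) 0 := by
      unfold UsNC.pairExponent
      fun_prop
    have e1 := hc.eventually_lt_const (by simpa using hu : UsNC.pairExponent (p + 0) σ' u < ξA)
    exact (e1.filter_mono nhdsWithin_le_nhds |>.and
      (self_mem_nhdsWithin (a := (0 : ℝ)) (s := Set.Ioi 0))).exists
  set e := UsNC.pairExponent (p + δ) σ' u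
  obtain ⟨a, hea, haξ⟩ := exists_between hδ
  obtain ⟨b, hRb, hbξ⟩ := exists_between hσ'R
  have hA := UsNC.eventually_mul_le_of_liminf hlA haξ
  have hB := UsNC.eventually_mul_le_of_liminf hlB hbξ
  obtain ⟨v, hv1, hq0, hq1⟩ := UsNC.exists_chernoff_base hp0 hδ0
  set q := v ^ (-(p + δ)) * (1 - p + p * v)
  set k : ℕ → ℕ := fun n => ⌊R' * n⌋₊
  set s : ℕ → ℕ := fun n => ⌊UsNC.h (2 * σ') * n⌋₊ + 1
  have hcode : ∀ n, ∃ H : Matrix (Fin (s n)) (Fin n) (ZMod 2), ∀ x : UsNC.Bits n, x ≠ 0 →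
      (hammingNorm x : ℝ) ≤ 2 * σ' * n → H.mulVec x ≠ 0 := by
    intro n
    apply UsNC.exists_parityCheck
    have h1 := UsNC.card_ball_le_two_rpow (n := n) (by linarith : 0 < 2 * σ') (by linarith)
    have h2 : (2 : ℝ) ^ (n * UsNC.h (2 * σ')) < (2 : ℝ) ^ ((s n : ℕ) : ℝ) := by
      apply Real.rpow_lt_rpow_of_exponent_lt one_lt_two
      rw [mul_comm]
      exact_mod_cast Nat.lt_floor_add_one (UsNC.h (2 * σ') * n)
    rw [Real.rpow_natCast] at h2
    exact_mod_cast h1.trans_lt h2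
  choose H hH using hcode
  refine ⟨fun n => UsNC.Bits (k n), fun n => inferInstance, fun n => inferInstance,
    fun n => UsNC.hashProtocol (k n) (H n) ((p + δ) * n), ?_, ?_, ?_, ?_⟩
  · have hlim : Tendsto (fun n : ℕ => ENNReal.ofReal (q ^ n)) atTop (𝓝 0) := by
      have := ENNReal.tendsto_ofReal (tendsto_pow_atTop_nhds_zero_of_lt_one hq0 hq1)
      rwa [ENNReal.ofReal_zero] at this
    refine tendsto_of_tendsto_of_tendsto_of_le_of_le tendsto_const_nhds hlim
      (fun _ => zero_le) fun n => ?_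
    refine UsNC.deltaC_hashProtocol_le _ _ _ fun x => ?_
    refine (UsNC.bsc_toOuterMeasure_le (θ n) x hv1 _).trans (le_of_eq ?_)
    rw [hp, ← neg_mul, Real.rpow_mul_natCast (by linarith), ← mul_pow]
  · have hγ : 0 < (b - (R' + UsNC.h (2 * σ'))) / 2 := by linarith
    have hlim : Tendsto (fun n : ℕ => ENNReal.ofReal
        (2 * (2 : ℝ) ^ (1 - (b - (R' + UsNC.h (2 * σ'))) / 2 * n) + 4 * (θ n).epsB))
        atTop (𝓝 0) := by
      have := ENNReal.tendsto_ofReal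
        (((UsNC.tendsto_two_rpow_sub_mul 1 hγ).const_mul 2).add (hepsB.const_mul 4))
      simpa using this
    refine tendsto_of_tendsto_of_tendsto_of_le_of_le' tendsto_const_nhds hlim
      (Eventually.of_forall fun _ => zero_le) ?_
    filter_upwards [hB] with n hn
    refine (UsNC.deltaH_hashProtocol_le _ _ _).trans (ENNReal.ofReal_le_ofReal ?_)
    have hk : (k n : ℝ) ≤ R' * n := Nat.floor_le (by positivity)
    have hs : (s n : ℝ) ≤ UsNC.h (2 * σ') * n + 1 := by
      have := Nat.floor_le (by positivity : 0 ≤ UsNC.h (2 * σ') * n)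
      simp only [s]; push_cast; linarith
    have : (2 : ℝ) ^ ((1 - (θ n).lB + s n + k n) / 2)
        ≤ (2 : ℝ) ^ (1 - (b - (R' + UsNC.h (2 * σ'))) / 2 * n) := by
      apply Real.rpow_le_rpow_of_exponent_le one_le_two
      linarith
    linarith
  · have hlim : Tendsto (fun n : ℕ => ENNReal.ofReal
        ((2 : ℝ) ^ (1 - (a - e) * n) + 2 * (θ n).epsA)) atTop (𝓝 0) := by
      have := ENNReal.tendsto_ofReal
        ((UsNC.tendsto_two_rpow_sub_mul 1 (sub_pos.2 hea)).add (hepsA.const_mul 2))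
      simpa using this
    refine tendsto_of_tendsto_of_tendsto_of_le_of_le' tendsto_const_nhds hlim
      (Eventually.of_forall fun _ => zero_le) ?_
    filter_upwards [hA] with n hn
    refine UsNC.deltaB_hashProtocol_le _ _ _ (hH n) fun P hP x₀ x₁ hD => ?_
    classical
    refine (UsNC.toOuterMeasure_le_of_smoothHminC P hP _).trans (ENNReal.ofReal_le_ofReal ?_)
    have h1 := UsNC.card_inter_ball_le_two_rpow hu0 hu1.le (p + δ) σ' x₀ x₁ hD
    have h2 : (2 : ℝ) ^ (n * e) * (2 : ℝ) ^ (1 - (θ n).lA) ≤ (2 : ℝ) ^ (1 - (a - e) * n) := by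
      rw [← Real.rpow_add two_pos]
      apply Real.rpow_le_rpow_of_exponent_le one_le_two
      linarith
    refine add_le_add (le_trans ?_ h2) le_rfl
    refine mul_le_mul_of_nonneg_right ?_ (by positivity)
    refine le_trans (Nat.cast_le.2 (Finset.card_le_card fun z hz => ?_)) h1
    simpa using hz
  · have h1 : ∀ n, Real.logb 2 (Fintype.card (UsNC.Bits (k n))) = k n := by
      intro n
      rw [Fintype.card_fun, ZMod.card, Fintype.card_fin, Nat.cast_pow, Nat.cast_ofNat,
        Real.logb_pow, Real.logb_self_eq_one one_lt_two, mul_one]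
    simp_rw [h1]
    exact (tendsto_nat_floor_mul_div_atTop hR0).comp tendsto_natCast_atTop_atTop
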